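/- Let $\mathfrak{Lie}$ be the Lie operad over $\mathbb{Q}$: for a finite set $S$, $\mathfrak{Lie}(S)$ is the multilinear part of the free Lie algebra on $S$ (spanned by the iterated brackets in which each element of $S$ occurs exactly once), with composition given by substitution. Let $\mathbf{Cat}\,\mathfrak{Lie}$ be the associated PROP: the $\mathbb{Q}$-linear category with objects the natural numbers and $$\mathbf{Cat}\,\mathfrak{Lie}(m,n)=\bigoplus_{f:\{1,\dots,m\}\twoheadrightarrow\{1,\dots,n\}}\ \bigotimes_{i=1}^n \mathfrak{Lie}(f^{-1}(i)),$$ which is the multilinear part of $\mathsf{Lie}(x_1,\dots,x_m)^{\otimes n}$, where $\mathsf{Lie}(x_1,\dots,x_m)$ is the free Lie algebra on $x_1,\dots,x_m$; composition is by substitution. It has the $\mathbb{Q}$-linear endofunctor $-\boxplus 1$, $n\mapsto n+1$. A $\mathbf{Cat}\,\mathfrak{Lie}$-bimodule is a family $B(m,n)$ of $\mathbb{Q}$-vector spaces with commuting $\mathbb{Q}$-linear actions of $\mathbf{Cat}\,\mathfrak{Lie}$, covariant in $n$ (left action) and contravariant in $m$ (right action). The category $\mathbf{Cat}\,\mathfrak{Lie}$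 is a bimodule over itself. Let $\delta\mathbf{Cat}\,\mathfrak{Lie}(m,n)=\mathbf{Cat}\,\mathfrak{Lie}(m,n+1)$ be the bimodule obtained by precomposing the left action with $-\boxplus 1$. For $n\in\mathbb{N}$ let $$\mu(n)=\sum_{i=1}^n x_1\otimes\cdots\otimes[x_i,x_{n+1}]\otimes\cdots\otimes x_n\in\mathbf{Cat}\,\mathfrak{Lie}(n+1,n)$$ (so $\mu(0)=0$), and let $\widetilde\mu:\delta\mathbf{Cat}\,\mathfrak{Lie}\to\mathbf{Cat}\,\mathfrak{Lie}$ be given by the left action of (that is, composition with) $\mu(n)$. Let $\delta^{(1)}\mathbf{Cat}\,\mathfrak{Lie}(m,n)\subseteq\delta\mathbf{Cat}\,\mathfrak{Lie}(m,n)$ be the sum of the summands indexed by the surjections $f:\{1,\dots,m\}\twoheadrightarrow\{1,\dots,n+1\}$ with $|f^{-1}(n+1)|=1$, and let $\widetilde\mu^{(1)}:\delta^{(1)}\mathbf{Cat}\,\mathfrak{Lie}\to\mathbf{Cat}\,\mathfrak{Lie}$ be the restriction of $\widetilde\mu$. Let $\pi:\delta\mathbf{Cat}\,\mathfrak{Lie}\to\delta^{(1)}\mathbf{Cat}\,\mathfrak{Lie}$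 be the following family of linear maps. For $Z\in\mathsf{Lie}(x_1,\dots,x_m)^{\otimes n}$ and $x\in\mathsf{Lie}(x_1,\dots,x_m)$, write $Z\cdot x$ for the $n$-fold tensor product of the right adjoint action, $(z_1\otimes\cdots\otimes z_n)\cdot x=\sum_i z_1\otimes\cdots\otimes[z_i,x]\otimes\cdots\otimes z_n$, and extend it to a right action of the free unital associative algebra $T(x_1,\dots,x_m)\supseteq\mathsf{Lie}(x_1,\dots,x_m)$. Then $\pi(Z\otimes P)=\sum_{j=1}^m (Z\cdot P_j)\otimes x_j$, where $P\in\mathsf{Lie}(x_1,\dots,x_m)$ is written uniquely as $P=\sum_j P_jx_j$ with $P_j\in T(x_1,\dots,x_m)$. Then there is a unique $\mathbf{Cat}\,\mathfrak{Lie}$-bimodule structure on $\delta^{(1)}\mathbf{Cat}\,\mathfrak{Lie}$ such that $\pi$ is a morphism of $\mathbf{Cat}\,\mathfrak{Lie}$-bimodules, and with respect to this structure $$\widetilde\mu^{(1)}:\delta^{(1)}\mathbf{Cat}\,\mathfrak{Lie}\to\mathbf{Cat}\,\mathfrak{Lie}$$ is a morphism of $\mathbf{Cat}\,\mathfrak{Lie}$-bimodules.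 -/

import Mathlib

open CategoryTheory
open scoped TensorProduct

noncomputable section

namespace LieProp

/-! ## The Lie operad: multilinear parts of free Lie algebras -/

/-- `IsLieMonomial S z`: the element `z` of the free Lie algebra on `X` is an iterated bracket of
generators in which every element of the finite set `S` occurs exactly once and no other
generator occurs. -/
inductive IsLieMonomial {X : Type} [DecidableEq X] : Finset X → FreeLieAlgebra ℚ X → Prop
  | of (x : X) : IsLieMonomial {x} (FreeLieAlgebra.of ℚ x)
  | lie {S T : Finset X} {a b : FreeLieAlgebra ℚ X} (h : Disjoint S T)
      (ha : IsLieMonomial S a) (hb : IsLieMonomial T b) : IsLieMonomial (S ∪ T) ⁅a, b⁆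

/-- The value `𝔏𝔦𝔢(S)` of the Lie operad on a finite set `S`, realised as the multilinear part
(on the generators in `S`) of the free Lie algebra on an alphabet `X ⊇ S`.
Operadic composition is substitution. -/
def lieOn {X : Type} [DecidableEq X] (S : Finset X) : Submodule ℚ (FreeLieAlgebra ℚ X) :=
  Submodule.span ℚ {z | IsLieMonomial S z}

/-- The subspace `⨂ᵢ 𝔏𝔦𝔢(f⁻¹(i))` of `Lie(X)^{⊗ n}` for a map `f : X → {1, …, n}`. -/
def tensorsOfType {X : Type} [Fintype X] [DecidableEq X] {n : ℕ} (f : X → Fin n) :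
    Submodule ℚ (⨂[ℚ] _ : Fin n, FreeLieAlgebra ℚ X) :=
  Submodule.span ℚ {t | ∃ z : Fin n → FreeLieAlgebra ℚ X,
    (∀ i, z i ∈ lieOn (Finset.univ.filter fun x => f x = i)) ∧ t = PiTensorProduct.tprod ℚ z}

/-- The morphism space `Cat 𝔏𝔦𝔢(m, n) = ⨁_f ⨂ᵢ 𝔏𝔦𝔢(f⁻¹(i))`, the sum being over all surjections
`f : {1, …, m} → {1, …, n}`, realised inside `Lie(x₁, …, x_m)^{⊗ n}`
(the sum is direct: see `iSupIndep_tensorsOfType`). -/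
def catLieHom (m n : ℕ) : Submodule ℚ (⨂[ℚ] _ : Fin n, FreeLieAlgebra ℚ (Fin m)) :=
  ⨆ f : {f : Fin m → Fin n // Function.Surjective f}, tensorsOfType f.1

section Basics

variable {X : Type} [DecidableEq X]

theorem of_mem_lieOn (x : X) : FreeLieAlgebra.of ℚ x ∈ lieOn {x} :=
  Submodule.subset_span (IsLieMonomial.of x)

theorem lie_mem_lieOn {S T : Finset X} (h : Disjoint S T) {a b : FreeLieAlgebra ℚ X}
    (ha : a ∈ lieOn S) (hb : b ∈ lieOn T) : ⁅a, b⁆ ∈ lieOn (S ∪ T) := by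
  induction ha using Submodule.span_induction with
  | mem a ha =>
    induction hb using Submodule.span_induction with
    | mem b hb => exact Submodule.subset_span (IsLieMonomial.lie h ha hb)
    | zero => simp
    | add x y _ _ hx hy => rw [lie_add]; exact add_mem hx hy
    | smul c x _ hx => rw [lie_smul]; exact Submodule.smul_mem _ _ hx
  | zero => simp
  | add x y _ _ hx hy => rw [add_lie]; exact add_mem hx hy
  | smul c x _ hx => rw [smul_lie]; exact Submodule.smul_mem _ _ hx

theorem IsLieMonomial.nonempty {S : Finset X} {z : FreeLieAlgebra ℚ X}
    (h : IsLieMonomial S z) : S.Nonempty := by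
  induction h with
  | of x => exact Finset.singleton_nonempty x
  | lie h _ _ ha _ => exact ha.mono Finset.subset_union_left

theorem eq_zero_of_mem_lieOn_empty {z : FreeLieAlgebra ℚ X} (h : z ∈ lieOn (∅ : Finset X)) :
    z = 0 := by
  induction h using Submodule.span_induction with
  | mem a ha => exact absurd ha.nonempty (by simp)
  | zero => rfl
  | add x y _ _ hx hy => rw [hx, hy, add_zero]
  | smul c x _ hx => rw [hx, smul_zero]

variable {L : Type*} [LieRing L] [LieAlgebra ℚ L]

theorem lift_congr_of_mem {S : Finset X} {z : FreeLieAlgebra ℚ X} (h : z ∈ lieOn S)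
    {a b : X → L} (hab : ∀ x ∈ S, a x = b x) :
    FreeLieAlgebra.lift ℚ a z = FreeLieAlgebra.lift ℚ b z := by
  induction h using Submodule.span_induction with
  | mem z hz =>
    induction hz with
    | of x => simpa using hab x (by simp)
    | lie h _ _ ha hb =>
      rw [LieHom.map_lie, LieHom.map_lie, ha fun x hx => hab x (Finset.mem_union_left _ hx),
        hb fun x hx => hab x (Finset.mem_union_right _ hx)]
  | zero => simp
  | add x y _ _ hx hy => rw [map_add, map_add, hx, hy]
  | smul c x _ hx => rw [map_smul, map_smul, hx]

theorem lift_update_add {S : Finset X} {z : FreeLieAlgebra ℚ X} (h : z ∈ lieOn S)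
    {i : X} (hi : i ∈ S) (a : X → L) (u v : L) :
    FreeLieAlgebra.lift ℚ (Function.update a i (u + v)) z =
      FreeLieAlgebra.lift ℚ (Function.update a i u) z +
        FreeLieAlgebra.lift ℚ (Function.update a i v) z := by
  induction h using Submodule.span_induction with
  | mem z hz =>
    induction hz with
    | of x =>
      obtain rfl : i = x := by simpa using hi
      simp
    | @lie S T p q h hp hq hp' hq' =>
      simp only [LieHom.map_lie]
      rcases Finset.mem_union.1 hi with hi | hi
      · have hT : i ∉ T := Finset.disjoint_left.1 h hi
        have key : ∀ w w' : L, FreeLieAlgebra.lift ℚ (Function.update a i w) q =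
            FreeLieAlgebra.lift ℚ (Function.update a i w') q := fun w w' =>
          lift_congr_of_mem (Submodule.subset_span hq) fun x hx => by
            have : x ≠ i := fun e => hT (e ▸ hx)
            simp [Function.update_of_ne this]
        rw [hp' hi, add_lie, key (u + v) u, key v u]
      · have hS : i ∉ S := Finset.disjoint_right.1 h hi
        have key : ∀ w w' : L, FreeLieAlgebra.lift ℚ (Function.update a i w) p =
            FreeLieAlgebra.lift ℚ (Function.update a i w') p := fun w w' =>
          lift_congr_of_mem (Submodule.subset_span hp) fun x hx => by
            have : x ≠ i := fun e => hS (e ▸ hx)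
            simp [Function.update_of_ne this]
        rw [hq' hi, lie_add, key (u + v) u, key v u]
  | zero => simp
  | add x y _ _ hx hy => simp only [map_add, hx, hy]; abel
  | smul c x _ hx => simp only [map_smul, hx, smul_add]

theorem lift_update_smul {S : Finset X} {z : FreeLieAlgebra ℚ X} (h : z ∈ lieOn S)
    {i : X} (hi : i ∈ S) (a : X → L) (c : ℚ) (u : L) :
    FreeLieAlgebra.lift ℚ (Function.update a i (c • u)) z =
      c • FreeLieAlgebra.lift ℚ (Function.update a i u) z := by
  induction h using Submodule.span_induction with
  | mem z hz =>
    induction hz with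
    | of x =>
      obtain rfl : i = x := by simpa using hi
      simp
    | @lie S T p q h hp hq hp' hq' =>
      simp only [LieHom.map_lie]
      rcases Finset.mem_union.1 hi with hi | hi
      · have hT : i ∉ T := Finset.disjoint_left.1 h hi
        have key : FreeLieAlgebra.lift ℚ (Function.update a i (c • u)) q =
            FreeLieAlgebra.lift ℚ (Function.update a i u) q :=
          lift_congr_of_mem (Submodule.subset_span hq) fun x hx => by
            have : x ≠ i := fun e => hT (e ▸ hx)
            simp [Function.update_of_ne this]
        rw [hp' hi, smul_lie, key]
      · have hS : i ∉ S := Finset.disjoint_right.1 h hi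
        have key : FreeLieAlgebra.lift ℚ (Function.update a i (c • u)) p =
            FreeLieAlgebra.lift ℚ (Function.update a i u) p :=
          lift_congr_of_mem (Submodule.subset_span hp) fun x hx => by
            have : x ≠ i := fun e => hS (e ▸ hx)
            simp [Function.update_of_ne this]
        rw [hq' hi, lie_smul, key]
  | zero => simp
  | add x y _ _ hx hy => simp only [map_add, hx, hy, smul_add]
  | smul d x _ hx => simp only [map_smul, hx, smul_comm c d]

/-- Substitution of multilinear elements on disjoint sets of variables into a multilinear element
is multilinear: this is the composition of the Lie operad. -/
theorem lift_mem_lieOn {Y : Type} [DecidableEq Y] {S : Finset X} {z : FreeLieAlgebra ℚ X}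
    (h : z ∈ lieOn S) (c : X → Finset Y) (hc : ∀ i j, i ≠ j → Disjoint (c i) (c j))
    {a : X → FreeLieAlgebra ℚ Y} (ha : ∀ x, a x ∈ lieOn (c x)) :
    FreeLieAlgebra.lift ℚ a z ∈ lieOn (S.biUnion c) := by
  induction h using Submodule.span_induction with
  | mem z hz =>
    induction hz with
    | of x => simpa using ha x
    | @lie S T p q h hp hq hp' hq' =>
      rw [LieHom.map_lie, Finset.union_biUnion]
      refine lie_mem_lieOn ?_ hp' hq'
      rw [Finset.disjoint_biUnion_left]
      intro i hi
      rw [Finset.disjoint_biUnion_right]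
      intro j hj
      exact hc i j fun e => Finset.disjoint_left.1 h hi (e ▸ hj)
  | zero => simp
  | add x y _ _ hx hy => rw [map_add]; exact add_mem hx hy
  | smul c x _ hx => rw [map_smul]; exact Submodule.smul_mem _ _ hx

theorem lift_eq_zero_of_mem {S : Finset X} {z : FreeLieAlgebra ℚ X} (h : z ∈ lieOn S)
    {i : X} (hi : i ∈ S) {a : X → L} (ha : a i = 0) : FreeLieAlgebra.lift ℚ a z = 0 := by
  have h0 : Function.update a i 0 = a := by rw [Function.update_eq_self_iff, ha]
  have := lift_update_smul h hi a 0 0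
  rwa [zero_smul, zero_smul, h0] at this

end Basics

/-- Evaluate the `i`-th tensor factor after setting to zero all generators outside `f⁻¹(i)`. -/
def typeProjection {X : Type} {n : ℕ} (f : X → Fin n) :
    (⨂[ℚ] _ : Fin n, FreeLieAlgebra ℚ X) →ₗ[ℚ] ⨂[ℚ] _ : Fin n, FreeLieAlgebra ℚ X :=
  PiTensorProduct.map fun i => (FreeLieAlgebra.lift ℚ fun x =>
    if f x = i then FreeLieAlgebra.of ℚ x else 0 : _ →ₗ⁅ℚ⁆ FreeLieAlgebra ℚ X).toLinearMap

theorem typeProjection_self {X : Type} [Fintype X] [DecidableEq X] {n : ℕ} (f : X → Fin n)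
    {t : ⨂[ℚ] _ : Fin n, FreeLieAlgebra ℚ X} (h : t ∈ tensorsOfType f) :
    typeProjection f t = t := by
  induction h using Submodule.span_induction with
  | mem t ht =>
    obtain ⟨z, hz, rfl⟩ := ht
    rw [typeProjection, PiTensorProduct.map_tprod]
    congr 1
    funext i
    have h1 := lift_congr_of_mem (hz i)
      (a := fun x => if f x = i then FreeLieAlgebra.of ℚ x else 0)
      (b := FreeLieAlgebra.of ℚ) fun x hx => by simp [(Finset.mem_filter.1 hx).2]
    refine h1.trans ?_
    have : FreeLieAlgebra.lift ℚ (FreeLieAlgebra.of ℚ) =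
        (LieHom.id : FreeLieAlgebra ℚ X →ₗ⁅ℚ⁆ FreeLieAlgebra ℚ X) :=
      FreeLieAlgebra.hom_ext fun x => by simp
    rw [this]; rfl
  | zero => simp
  | add x y _ _ hx hy => rw [map_add, hx, hy]
  | smul c x _ hx => rw [map_smul, hx]

theorem typeProjection_of_ne {X : Type} [Fintype X] [DecidableEq X] {n : ℕ} {f g : X → Fin n}
    (hfg : f ≠ g) {t : ⨂[ℚ] _ : Fin n, FreeLieAlgebra ℚ X} (h : t ∈ tensorsOfType g) :
    typeProjection f t = 0 := by
  induction h using Submodule.span_induction with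
  | mem t ht =>
    obtain ⟨z, hz, rfl⟩ := ht
    obtain ⟨x, hx⟩ := Function.ne_iff.1 hfg
    rw [typeProjection, PiTensorProduct.map_tprod]
    refine MultilinearMap.map_coord_zero _ (g x) ?_
    exact lift_eq_zero_of_mem (hz (g x)) (i := x) (by simp) (by simp [hx])
  | zero => simp
  | add x y _ _ hx hy => rw [map_add, hx, hy, add_zero]
  | smul c x _ hx => rw [map_smul, hx, smul_zero]

/-- The sum of the subspaces `⨂ᵢ 𝔏𝔦𝔢(f⁻¹(i))` over all maps `f` is direct. -/
theorem iSupIndep_tensorsOfType {X : Type} [Fintype X] [DecidableEq X] {n : ℕ} :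
    iSupIndep fun f : X → Fin n => tensorsOfType f := by
  intro f
  rw [Submodule.disjoint_def]
  intro t ht ht'
  rw [← typeProjection_self f ht]
  have : (⨆ (g) (_ : g ≠ f), tensorsOfType g) ≤ LinearMap.ker (typeProjection f) :=
    iSup₂_le fun g hg t ht => typeProjection_of_ne hg.symm ht
  exact this ht'

/-! ## The action of `Cat 𝔏𝔦𝔢` on the tensor powers of a Lie algebra -/

section Action

variable {L : Type*} [LieRing L] [LieAlgebra ℚ L]

theorem tensorsOfType_le {m n : ℕ} {f : Fin m → Fin n} (hf : Function.Surjective f) :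
    tensorsOfType f ≤ catLieHom m n :=
  le_iSup (fun f : {f : Fin m → Fin n // Function.Surjective f} => tensorsOfType f.1) ⟨f, hf⟩

/-- Induction principle for elements of `Cat 𝔏𝔦𝔢(m, n)`. -/
theorem catLieHom_induction {m n : ℕ} {P : (⨂[ℚ] _ : Fin n, FreeLieAlgebra ℚ (Fin m)) → Prop}
    (tprod : ∀ (f : Fin m → Fin n) (z : Fin n → FreeLieAlgebra ℚ (Fin m)),
      Function.Surjective f → (∀ i, z i ∈ lieOn (Finset.univ.filter fun x => f x = i)) →
      P (PiTensorProduct.tprod ℚ z))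
    (zero : P 0) (add : ∀ x y, P x → P y → P (x + y)) (smul : ∀ (c : ℚ) x, P x → P (c • x))
    {t} (ht : t ∈ catLieHom m n) : P t := by
  induction ht using Submodule.iSup_induction' with
  | mem f x hx =>
    induction hx using Submodule.span_induction with
    | mem x hx => obtain ⟨z, hz, rfl⟩ := hx; exact tprod f.1 z f.2 hz
    | zero => exact zero
    | add x y _ _ hx hy => exact add x y hx hy
    | smul c x _ hx => exact smul c x hx
  | zero => exact zero
  | add x y _ _ hx hy => exact add x y hx hy

/-- Substitution of elements `a₁, …, a_n` of a Lie algebra `L` for the generators,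
`Lie(x₁, …, x_n)^{⊗ p} → L^{⊗ p}`. -/
def subst {n : ℕ} (p : ℕ) (a : Fin n → L) :
    (⨂[ℚ] _ : Fin p, FreeLieAlgebra ℚ (Fin n)) →ₗ[ℚ] ⨂[ℚ] _ : Fin p, L :=
  PiTensorProduct.map fun _ => (FreeLieAlgebra.lift ℚ a : _ →ₗ⁅ℚ⁆ L).toLinearMap

theorem subst_tprod {n p : ℕ} (a : Fin n → L) (z : Fin p → FreeLieAlgebra ℚ (Fin n)) :
    subst p a (PiTensorProduct.tprod ℚ z) =
      PiTensorProduct.tprod ℚ fun j => FreeLieAlgebra.lift ℚ a (z j) := by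
  rw [subst, PiTensorProduct.map_tprod]; rfl

theorem subst_aux {n p : ℕ} (f : Fin n → Fin p) (z : Fin p → FreeLieAlgebra ℚ (Fin n))
    (hz : ∀ i, z i ∈ lieOn (Finset.univ.filter fun x => f x = i)) (a : Fin n → L) (i : Fin n)
    (w u : L) :
    (fun j => FreeLieAlgebra.lift ℚ (Function.update a i w) (z j)) =
      Function.update (fun j => FreeLieAlgebra.lift ℚ (Function.update a i u) (z j)) (f i)
        (FreeLieAlgebra.lift ℚ (Function.update a i w) (z (f i))) := by
  funext j
  by_cases hj : j = f i
  · subst hj; simp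
  · rw [Function.update_of_ne hj]
    refine lift_congr_of_mem (hz j) fun x hx => ?_
    have : x ≠ i := by rintro rfl; exact hj (Finset.mem_filter.1 hx).2.symm
    simp [Function.update_of_ne this]

theorem subst_update_add {n p : ℕ} {t : ⨂[ℚ] _ : Fin p, FreeLieAlgebra ℚ (Fin n)}
    (ht : t ∈ catLieHom n p) (a : Fin n → L) (i : Fin n) (u v : L) :
    subst p (Function.update a i (u + v)) t =
      subst p (Function.update a i u) t + subst p (Function.update a i v) t := by
  refine catLieHom_induction (P := fun t => subst p (Function.update a i (u + v)) t =
      subst p (Function.update a i u) t + subst p (Function.update a i v) t)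
    (fun f z _ hz => ?_) ?_ (fun x y hx hy => ?_) (fun c x hx => ?_) ht
  · rw [subst_tprod, subst_tprod, subst_tprod, subst_aux f z hz a i (u + v) u,
      subst_aux f z hz a i v u, lift_update_add (hz (f i)) (by simp), MultilinearMap.map_update_add,
      Function.update_eq_self]
  · simp only [map_zero, add_zero]
  · simp only [map_add, hx, hy]; abel
  · simp only [map_smul, hx, smul_add]

theorem subst_update_smul {n p : ℕ} {t : ⨂[ℚ] _ : Fin p, FreeLieAlgebra ℚ (Fin n)}
    (ht : t ∈ catLieHom n p) (a : Fin n → L) (i : Fin n) (c : ℚ) (u : L) :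
    subst p (Function.update a i (c • u)) t = c • subst p (Function.update a i u) t := by
  refine catLieHom_induction (P := fun t => subst p (Function.update a i (c • u)) t =
      c • subst p (Function.update a i u) t)
    (fun f z _ hz => ?_) ?_ (fun x y hx hy => ?_) (fun d x hx => ?_) ht
  · rw [subst_tprod, subst_tprod, subst_aux f z hz a i (c • u) u,
      lift_update_smul (hz (f i)) (by simp), MultilinearMap.map_update_smul,
      Function.update_eq_self]
  · simp only [map_zero, smul_zero]
  · simp only [map_add, hx, hy, smul_add]
  · simp only [map_smul, hx, smul_comm c d]

/-- The left `Cat 𝔏𝔦𝔢`-module structure `n ↦ L^{⊗ n}` of a Lie algebra `L`: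
`act φ (a₁ ⊗ ⋯ ⊗ a_n)` is obtained from `φ ∈ Cat 𝔏𝔦𝔢(n, p) ⊆ Lie(x₁, …, x_n)^{⊗ p}` by
substituting `a_i` for `x_i`. -/
def act {n p : ℕ} : catLieHom n p →ₗ[ℚ] (⨂[ℚ] _ : Fin n, L) →ₗ[ℚ] ⨂[ℚ] _ : Fin p, L :=
  (PiTensorProduct.lift
    ({ toFun := fun a => subst p a ∘ₗ (catLieHom n p).subtype
       map_update_add' := fun {inst} a i u v => by
         obtain rfl : inst = instDecidableEqFin n := Subsingleton.elim _ _
         exact LinearMap.ext fun t => subst_update_add t.2 a i u v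
       map_update_smul' := fun {inst} a i c u => by
         obtain rfl : inst = instDecidableEqFin n := Subsingleton.elim _ _
         exact LinearMap.ext fun t => subst_update_smul t.2 a i c u } :
      MultilinearMap ℚ (fun _ : Fin n => L) (catLieHom n p →ₗ[ℚ] ⨂[ℚ] _ : Fin p, L))).flip

theorem act_tprod {n p : ℕ} (φ : catLieHom n p) (a : Fin n → L) :
    act φ (PiTensorProduct.tprod ℚ a) = subst p a φ.1 := by
  rw [act, LinearMap.flip_apply, PiTensorProduct.lift.tprod]; rfl

theorem act_mem {m n p : ℕ} (φ : catLieHom n p)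
    {t : ⨂[ℚ] _ : Fin n, FreeLieAlgebra ℚ (Fin m)} (ht : t ∈ catLieHom m n) :
    act φ t ∈ catLieHom m p := by
  refine catLieHom_induction (P := fun t => act φ t ∈ catLieHom m p) (fun f a hf ha => ?_) ?_
    (fun x y hx hy => ?_) (fun c x hx => ?_) ht
  · rw [act_tprod]
    refine catLieHom_induction (P := fun t => subst p a t ∈ catLieHom m p)
      (fun g z hg hz => ?_) ?_ (fun x y hx hy => ?_) (fun c x hx => ?_) φ.2
    · rw [subst_tprod]
      refine tensorsOfType_le (hg.comp hf) (Submodule.subset_span ⟨_, fun j => ?_, rfl⟩)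
      have := lift_mem_lieOn (hz j) (fun i => Finset.univ.filter fun x => f x = i)
        (fun i j hij => Finset.disjoint_filter.2 fun x _ h1 h2 => hij (h1.symm.trans h2)) ha
      convert this using 2
      ext x; simp
    · rw [map_zero]; exact zero_mem _
    · rw [map_add]; exact add_mem hx hy
    · rw [map_smul]; exact Submodule.smul_mem _ _ hx
  · rw [map_zero]; exact zero_mem _
  · rw [map_add]; exact add_mem hx hy
  · rw [map_smul]; exact Submodule.smul_mem _ _ hx

/-- Composition in `Cat 𝔏𝔦𝔢`: `catComp ψ φ = ψ ∘ φ`. -/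
def catComp {m n p : ℕ} : catLieHom n p →ₗ[ℚ] catLieHom m n →ₗ[ℚ] catLieHom m p :=
  LinearMap.mk₂ ℚ (fun ψ φ => ⟨act ψ φ.1, act_mem ψ φ.2⟩)
    (fun _ _ _ => Subtype.ext (by simp)) (fun _ _ _ => Subtype.ext (by simp))
    (fun _ _ _ => Subtype.ext (by simp)) (fun _ _ _ => Subtype.ext (by simp))

theorem catComp_coe {m n p : ℕ} (ψ : catLieHom n p) (φ : catLieHom m n) :
    (catComp ψ φ).1 = act ψ φ.1 := rfl

/-- The identity `x₁ ⊗ ⋯ ⊗ x_n` of `n` in `Cat 𝔏𝔦𝔢`. -/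
def catId (n : ℕ) : catLieHom n n :=
  ⟨PiTensorProduct.tprod ℚ fun i => FreeLieAlgebra.of ℚ i,
    tensorsOfType_le (f := id) Function.surjective_id (Submodule.subset_span
      ⟨_, fun i => by simpa [Finset.filter_eq'] using of_mem_lieOn i, rfl⟩)⟩

theorem subst_of (n p : ℕ) :
    subst p (fun i : Fin n => FreeLieAlgebra.of ℚ i) = LinearMap.id := by
  have : FreeLieAlgebra.lift ℚ (FreeLieAlgebra.of ℚ) =
      (LieHom.id : FreeLieAlgebra ℚ (Fin n) →ₗ⁅ℚ⁆ FreeLieAlgebra ℚ (Fin n)) :=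
    FreeLieAlgebra.hom_ext fun x => by simp
  refine PiTensorProduct.ext (MultilinearMap.ext fun z => ?_)
  simp only [LinearMap.compMultilinearMap_apply, subst_tprod, LinearMap.id_apply]
  congr 1
  funext j
  exact congrArg (fun F : _ →ₗ⁅ℚ⁆ _ => F (z j)) this

theorem act_catId {n : ℕ} (t : ⨂[ℚ] _ : Fin n, L) : act (catId n) t = t := by
  have : act (L := L) (catId n) = LinearMap.id := by
    refine PiTensorProduct.ext (MultilinearMap.ext fun a => ?_)
    simp only [LinearMap.compMultilinearMap_apply, act_tprod, LinearMap.id_apply, catId,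
      subst_tprod, FreeLieAlgebra.lift_of_apply]
  rw [this]; rfl

theorem subst_subst {m n p : ℕ} (a : Fin m → L) (z : Fin n → FreeLieAlgebra ℚ (Fin m))
    (t : ⨂[ℚ] _ : Fin p, FreeLieAlgebra ℚ (Fin n)) :
    subst p a (subst p z t) = subst p (fun i => FreeLieAlgebra.lift ℚ a (z i)) t := by
  have : subst p a ∘ₗ subst p z = subst p (fun i => FreeLieAlgebra.lift ℚ a (z i)) := by
    refine PiTensorProduct.ext (MultilinearMap.ext fun y => ?_)
    simp only [LinearMap.compMultilinearMap_apply, LinearMap.comp_apply, subst_tprod]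
    congr 1
    funext j
    have h : (FreeLieAlgebra.lift ℚ a).comp (FreeLieAlgebra.lift ℚ z) =
        FreeLieAlgebra.lift ℚ (fun i => FreeLieAlgebra.lift ℚ a (z i)) :=
      FreeLieAlgebra.hom_ext fun x => by simp
    exact congrArg (fun F : _ →ₗ⁅ℚ⁆ _ => F (y j)) h
  exact congrArg (fun F : _ →ₗ[ℚ] _ => F t) this

/-- The action is natural with respect to substitutions. -/
theorem act_subst {m n p : ℕ} (φ : catLieHom n p) (a : Fin m → L)
    (t : ⨂[ℚ] _ : Fin n, FreeLieAlgebra ℚ (Fin m)) :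
    act φ (subst n a t) = subst p a (act φ t) := by
  have : act φ ∘ₗ subst n a = subst p a ∘ₗ act φ := by
    refine PiTensorProduct.ext (MultilinearMap.ext fun z => ?_)
    simp only [LinearMap.compMultilinearMap_apply, LinearMap.comp_apply, subst_tprod, act_tprod,
      subst_subst]
  exact congrArg (fun F : _ →ₗ[ℚ] _ => F t) this

theorem act_catComp {m n p : ℕ} (ψ : catLieHom n p) (φ : catLieHom m n)
    (t : ⨂[ℚ] _ : Fin m, L) : act (catComp ψ φ) t = act ψ (act φ t) := by
  have : act (L := L) (catComp ψ φ) = act ψ ∘ₗ act φ := by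
    refine PiTensorProduct.ext (MultilinearMap.ext fun a => ?_)
    simp only [LinearMap.compMultilinearMap_apply, LinearMap.comp_apply, act_tprod, act_subst,
      catComp_coe]
  rw [this]; rfl

end Action

/-! ## The `ℚ`-linear category `Cat 𝔏𝔦𝔢` -/

/-- The objects of the category `Cat 𝔏𝔦𝔢`: natural numbers. -/
structure CatLie where
  /-- the underlying natural number -/
  arity : ℕ

instance : Category CatLie where
  Hom m n := catLieHom m.arity n.arity
  id n := catId n.arity
  comp φ ψ := catComp ψ φ
  id_comp φ := Subtype.ext (by
    rw [catComp_coe, catId, act_tprod, subst_of]; rfl)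
  comp_id φ := Subtype.ext (act_catId _)
  assoc f g h := Subtype.ext (by simp only [catComp_coe, act_catComp])

instance : Preadditive CatLie where
  homGroup m n := inferInstanceAs (AddCommGroup (catLieHom m.arity n.arity))
  add_comp _ _ _ f f' g := (catComp g).map_add f f'
  comp_add _ _ _ f g g' := LinearMap.map_add₂ catComp g g' f

instance : Linear ℚ CatLie where
  homModule m n := inferInstanceAs (Module ℚ (catLieHom m.arity n.arity))
  smul_comp _ _ _ r f g := (catComp g).map_smul r f
  comp_smul _ _ _ f r g := LinearMap.map_smul₂ catComp r g f

/-! ## The functor `- ⊞ 1` -/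

section Snoc

variable {L : Type*} [LieRing L] [LieAlgebra ℚ L]

/-- The canonical bilinear map `L^{⊗ n} × L → L^{⊗ (n+1)}`, `(Z, X) ↦ Z ⊗ X`. -/
def snoc {n : ℕ} : (⨂[ℚ] _ : Fin n, L) →ₗ[ℚ] L →ₗ[ℚ] ⨂[ℚ] _ : Fin (n + 1), L :=
  PiTensorProduct.lift
    (PiTensorProduct.tprod ℚ : MultilinearMap ℚ (fun _ : Fin (n + 1) => L) _).curryRight

theorem snoc_tprod {n : ℕ} (z : Fin n → L) (x : L) :
    snoc (PiTensorProduct.tprod ℚ z) x =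
      PiTensorProduct.tprod ℚ (Fin.snoc z x : Fin (n + 1) → L) := by
  rw [snoc, PiTensorProduct.lift.tprod, MultilinearMap.curryRight_apply]

/-- The linear map `L^{⊗ (n+1)} = L^{⊗ n} ⊗ L → W` given by a bilinear map `L^{⊗ n} × L → W`. -/
def unsnoc {n : ℕ} {W : Type*} [AddCommGroup W] [Module ℚ W]
    (β : (⨂[ℚ] _ : Fin n, L) →ₗ[ℚ] L →ₗ[ℚ] W) : (⨂[ℚ] _ : Fin (n + 1), L) →ₗ[ℚ] W :=
  PiTensorProduct.lift (MultilinearMap.uncurryRight (M := fun _ : Fin (n + 1) => L)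
    (β.compMultilinearMap (PiTensorProduct.tprod ℚ)))

theorem unsnoc_tprod {n : ℕ} {W : Type*} [AddCommGroup W] [Module ℚ W]
    (β : (⨂[ℚ] _ : Fin n, L) →ₗ[ℚ] L →ₗ[ℚ] W) (z : Fin (n + 1) → L) :
    unsnoc β (PiTensorProduct.tprod ℚ z) =
      β (PiTensorProduct.tprod ℚ (Fin.init z)) (z (Fin.last n)) := by
  rw [unsnoc, PiTensorProduct.lift.tprod, MultilinearMap.uncurryRight_apply]; rfl

theorem subst_snoc {n p : ℕ} (a : Fin n → L) (Z : ⨂[ℚ] _ : Fin p, FreeLieAlgebra ℚ (Fin n))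
    (x : FreeLieAlgebra ℚ (Fin n)) :
    subst (p + 1) a (snoc Z x) = snoc (subst p a Z) (FreeLieAlgebra.lift ℚ a x) := by
  have : subst (p + 1) a ∘ₗ snoc.flip x =
      snoc.flip (FreeLieAlgebra.lift ℚ a x) ∘ₗ subst p a := by
    refine PiTensorProduct.ext (MultilinearMap.ext fun z => ?_)
    simp only [LinearMap.compMultilinearMap_apply, LinearMap.comp_apply, LinearMap.flip_apply,
      subst_tprod, snoc_tprod]
    congr 1
    funext j
    induction j using Fin.lastCases <;> simp
  exact congrArg (fun F : _ →ₗ[ℚ] _ => F Z) this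

theorem snoc_mem {n p : ℕ} {t : ⨂[ℚ] _ : Fin p, FreeLieAlgebra ℚ (Fin n)}
    (ht : t ∈ catLieHom n p) :
    snoc (subst p (fun i => FreeLieAlgebra.of ℚ i.castSucc) t)
      (FreeLieAlgebra.of ℚ (Fin.last n)) ∈ catLieHom (n + 1) (p + 1) := by
  refine catLieHom_induction (P := fun t =>
      snoc (subst p (fun i => FreeLieAlgebra.of ℚ i.castSucc) t)
        (FreeLieAlgebra.of ℚ (Fin.last n)) ∈ catLieHom (n + 1) (p + 1))
    (fun f z hf hz => ?_) ?_ (fun x y hx hy => ?_) (fun c x hx => ?_) ht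
  · rw [subst_tprod, snoc_tprod]
    refine tensorsOfType_le
      (f := Fin.snoc (α := fun _ => Fin (p + 1)) (fun i => (f i).castSucc) (Fin.last p)) ?_
      (Submodule.subset_span ⟨_, fun j => ?_, rfl⟩)
    · intro j
      induction j using Fin.lastCases with
      | last => exact ⟨Fin.last n, by simp⟩
      | cast j =>
        obtain ⟨i, rfl⟩ := hf j
        exact ⟨i.castSucc, by simp⟩
    · induction j using Fin.lastCases with
      | last =>
        rw [Fin.snoc_last]
        convert of_mem_lieOn (Fin.last n) using 2
        ext x
        induction x using Fin.lastCases <;> simp [Fin.castSucc_ne_last]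
      | cast j =>
        rw [Fin.snoc_castSucc]
        have := lift_mem_lieOn (hz j) (fun i => {i.castSucc})
          (fun i j hij => by simpa using fun h => hij h)
          (fun i => of_mem_lieOn i.castSucc)
        convert this using 2
        ext x
        induction x using Fin.lastCases with
        | last => simp [(Fin.castSucc_ne_last _).symm]
        | cast x => simp
  · simp only [map_zero, LinearMap.zero_apply]; exact zero_mem _
  · simp only [map_add, LinearMap.add_apply]; exact add_mem hx hy
  · simp only [map_smul, LinearMap.smul_apply]; exact Submodule.smul_mem _ _ hx

/-- The map `φ ↦ φ ⊞ 1`, from `Cat 𝔏𝔦𝔢(n, p)` to `Cat 𝔏𝔦𝔢(n + 1, p + 1)`. -/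
def boxOneMap {n p : ℕ} : catLieHom n p →ₗ[ℚ] catLieHom (n + 1) (p + 1) where
  toFun φ := ⟨snoc (subst p (fun i => FreeLieAlgebra.of ℚ i.castSucc) φ.1)
    (FreeLieAlgebra.of ℚ (Fin.last n)), snoc_mem φ.2⟩
  map_add' _ _ := Subtype.ext (by simp)
  map_smul' _ _ := Subtype.ext (by simp)

theorem boxOneMap_coe {n p : ℕ} (φ : catLieHom n p) :
    (boxOneMap φ).1 = snoc (subst p (fun i => FreeLieAlgebra.of ℚ i.castSucc) φ.1)
      (FreeLieAlgebra.of ℚ (Fin.last n)) := rfl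

theorem act_boxOneMap {n p : ℕ} (φ : catLieHom n p) (Z : ⨂[ℚ] _ : Fin n, L) (x : L) :
    act (boxOneMap φ) (snoc Z x) = snoc (act φ Z) x := by
  have : act (boxOneMap φ) ∘ₗ snoc.flip x = snoc.flip x ∘ₗ act φ := by
    refine PiTensorProduct.ext (MultilinearMap.ext fun z => ?_)
    simp only [LinearMap.compMultilinearMap_apply, LinearMap.comp_apply, LinearMap.flip_apply,
      snoc_tprod, act_tprod, boxOneMap_coe, subst_snoc, subst_subst, FreeLieAlgebra.lift_of_apply,
      Fin.snoc_castSucc, Fin.snoc_last]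
  exact congrArg (fun F : _ →ₗ[ℚ] _ => F Z) this

end Snoc

/-- The `ℚ`-linear endofunctor `- ⊞ 1` of `Cat 𝔏𝔦𝔢`. -/
def boxOne : CatLie ⥤ CatLie where
  obj n := ⟨n.arity + 1⟩
  map φ := boxOneMap φ
  map_id n := Subtype.ext (by
    change (boxOneMap (catId n.arity)).1 = (catId (n.arity + 1)).1
    rw [boxOneMap_coe, catId, catId, subst_tprod, snoc_tprod]
    congr 1
    funext j
    induction j using Fin.lastCases <;> simp)
  map_comp φ ψ := Subtype.ext (by
    change (boxOneMap (catComp ψ φ)).1 = (catComp (boxOneMap ψ) (boxOneMap φ)).1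
    rw [boxOneMap_coe, catComp_coe, catComp_coe, boxOneMap_coe φ, act_boxOneMap, act_subst])

instance : boxOne.Additive where
  map_add {_ _} f g := (boxOneMap).map_add f g

instance : boxOne.Linear ℚ where
  map_smul f r := (boxOneMap).map_smul r f

/-! ## Bimodules over a `ℚ`-linear category -/

/-- A `C`-bimodule structure on a family of `ℚ`-vector spaces `B m n`: it is covariant
(a left module) in `n` and contravariant (a right module) in `m`, and the two actions commute. -/
@[ext]
structure LinBimod (C : Type*) [Category C] [Preadditive C] [Linear ℚ C] (B : C → C → Type*)
    [∀ m n, AddCommGroup (B m n)] [∀ m n, Module ℚ (B m n)] where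
  /-- the left action -/
  left : ∀ {m n p : C}, (n ⟶ p) →ₗ[ℚ] B m n →ₗ[ℚ] B m p
  /-- the right action -/
  right : ∀ {l m n : C}, (l ⟶ m) →ₗ[ℚ] B m n →ₗ[ℚ] B l n
  left_id : ∀ {m n : C} (x : B m n), left (𝟙 n) x = x
  left_comp : ∀ {m n p q : C} (f : n ⟶ p) (g : p ⟶ q) (x : B m n),
    left (f ≫ g) x = left g (left f x)
  right_id : ∀ {m n : C} (x : B m n), right (𝟙 m) x = x
  right_comp : ∀ {k l m n : C} (f : k ⟶ l) (g : l ⟶ m) (x : B m n),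
    right (f ≫ g) x = right f (right g x)
  left_right : ∀ {l m n p : C} (f : l ⟶ m) (g : n ⟶ p) (x : B m n),
    left g (right f x) = right f (left g x)

namespace LinBimod

variable {C : Type*} [Category C] [Preadditive C] [Linear ℚ C]

/-- `C` as a bimodule over itself. -/
def regular (C : Type*) [Category C] [Preadditive C] [Linear ℚ C] :
    LinBimod C (fun m n : C => (m ⟶ n)) where
  left := (Linear.comp _ _ _).flip
  right := Linear.comp _ _ _
  left_id x := Category.comp_id x
  left_comp f g x := (Category.assoc x f g).symm
  right_id x := Category.id_comp x
  right_comp f g x := Category.assoc f g x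
  left_right f g x := Category.assoc f x g

variable {B : C → C → Type*} [∀ m n, AddCommGroup (B m n)] [∀ m n, Module ℚ (B m n)]
  {B' : C → C → Type*} [∀ m n, AddCommGroup (B' m n)] [∀ m n, Module ℚ (B' m n)]

/-- Precomposition of the left module structure with a linear endofunctor. -/
def shift (F : C ⥤ C) [F.Additive] [F.Linear ℚ] (β : LinBimod C B) :
    LinBimod C (fun m n => B m (F.obj n)) where
  left := β.left ∘ₗ F.mapLinearMap ℚ
  right := β.right
  left_id x := by simp [β.left_id]
  left_comp f g x := by simp [β.left_comp]
  right_id x := β.right_id x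
  right_comp f g x := β.right_comp f g x
  left_right f g x := β.left_right f _ x

/-- A family of linear maps is a morphism of bimodules if it commutes with both actions. -/
structure IsHom (β : LinBimod C B) (β' : LinBimod C B') (F : ∀ m n, B m n →ₗ[ℚ] B' m n) :
    Prop where
  map_left : ∀ {m n p : C} (g : n ⟶ p) (x : B m n), F m p (β.left g x) = β'.left g (F m n x)
  map_right : ∀ {l m n : C} (f : l ⟶ m) (x : B m n), F l n (β.right f x) = β'.right f (F m n x)

end LinBimod

/-- The bimodule `Cat 𝔏𝔦𝔢`. -/
abbrev catLieBimod : LinBimod CatLie (fun m n => (m ⟶ n)) := LinBimod.regular CatLie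

/-- The bimodule `δ Cat 𝔏𝔦𝔢`, with `δ Cat 𝔏𝔦𝔢(m, n) = Cat 𝔏𝔦𝔢(m, n ⊞ 1)`. -/
abbrev deltaCatLie : LinBimod CatLie (fun m n => (m ⟶ boxOne.obj n)) :=
  catLieBimod.shift boxOne

/-! ## The morphisms `μ(n)` and the transformation `μ̃` -/

theorem muTerm_mem {n : ℕ} (i : Fin n) :
    PiTensorProduct.tprod ℚ (Function.update
      (fun j : Fin n => FreeLieAlgebra.of ℚ j.castSucc) i
        ⁅FreeLieAlgebra.of ℚ i.castSucc, FreeLieAlgebra.of ℚ (Fin.last n)⁆) ∈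
      catLieHom (n + 1) n := by
  refine tensorsOfType_le (f := Fin.snoc (α := fun _ => Fin n) id i)
    (fun j => ⟨j.castSucc, by simp⟩) (Submodule.subset_span ⟨_, fun j => ?_, rfl⟩)
  by_cases h : j = i
  · subst h
    rw [Function.update_self]
    have := lie_mem_lieOn (by simp [Fin.castSucc_ne_last])
      (of_mem_lieOn j.castSucc) (of_mem_lieOn (Fin.last n))
    convert this using 2
    ext x
    induction x using Fin.lastCases <;> simp [Fin.castSucc_ne_last]
  · rw [Function.update_of_ne h]
    convert of_mem_lieOn j.castSucc using 2
    ext x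
    induction x using Fin.lastCases <;> simp [(Fin.castSucc_ne_last _).symm, Ne.symm h]

/-- The element `μ(n) = ∑ᵢ x₁ ⊗ ⋯ ⊗ [xᵢ, x_{n+1}] ⊗ ⋯ ⊗ x_n` of `Cat 𝔏𝔦𝔢(n + 1, n)`; the `i`-th
term is the generator for the surjection that is the identity on `{1, …, n}` and sends
`n + 1` to `i`. -/
def mu (n : ℕ) : catLieHom (n + 1) n := ∑ i : Fin n, ⟨_, muTerm_mem i⟩

/-- The morphism `μ̃ : δ B → B` for a `Cat 𝔏𝔦𝔢`-bimodule `B`, given by the action of `μ(n)`. -/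
def muTilde {B : CatLie → CatLie → Type*} [∀ m n, AddCommGroup (B m n)]
    [∀ m n, Module ℚ (B m n)] (β : LinBimod CatLie B) (m n : CatLie) :
    B m (boxOne.obj n) →ₗ[ℚ] B m n :=
  β.left (show boxOne.obj n ⟶ n from mu n.arity)

/-! ## The sub-object `δ⁽¹⁾ Cat 𝔏𝔦𝔢` -/

/-- The summands of `Lie(x₁, …, x_m)^{⊗ (n+1)}` for the surjections `f` from `{1, …, m}` to
`{1, …, n + 1}` such that `f⁻¹(n + 1)` has exactly one element. -/
def delta1Tensors (m n : ℕ) : Submodule ℚ (⨂[ℚ] _ : Fin (n + 1), FreeLieAlgebra ℚ (Fin m)) :=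
  ⨆ f : {f : Fin m → Fin (n + 1) // Function.Surjective f ∧
    (Finset.univ.filter fun x => f x = Fin.last n).card = 1}, tensorsOfType f.1

/-- The subspace `δ⁽¹⁾ Cat 𝔏𝔦𝔢(m, n)` of `δ Cat 𝔏𝔦𝔢(m, n) = Cat 𝔏𝔦𝔢(m, n ⊞ 1)`, corresponding
to `Cat 𝔏𝔦𝔢 ⊙ I ⊆ Cat 𝔏𝔦𝔢 ⊙ 𝔏𝔦𝔢`. -/
def delta1 (m n : CatLie) : Submodule ℚ (m ⟶ boxOne.obj n) :=
  (delta1Tensors m.arity n.arity).comap (catLieHom m.arity (n.arity + 1)).subtype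

/-- The restriction `μ̃⁽¹⁾ : δ⁽¹⁾ Cat 𝔏𝔦𝔢 → Cat 𝔏𝔦𝔢` of `μ̃`. -/
def muTilde1 (m n : CatLie) : delta1 m n →ₗ[ℚ] (m ⟶ n) :=
  muTilde catLieBimod m n ∘ₗ (delta1 m n).subtype

/-! ## The projection `π : δ Cat 𝔏𝔦𝔢 → δ⁽¹⁾ Cat 𝔏𝔦𝔢` -/

section Projection

attribute [local instance] LieRing.ofAssociativeRing

/-- The inclusion `Lie(X) → T(X)` of the free Lie algebra in the free unital associative algebra,
corresponding to `𝔏𝔦𝔢 ⊆ 𝔄𝔰𝔰 ⊆ 𝔄𝔰𝔰ᵘ` (the commutator bracket). -/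
def toAss (X : Type) : FreeLieAlgebra ℚ X →ₗ[ℚ] FreeAlgebra ℚ X :=
  (FreeLieAlgebra.lift ℚ (FreeAlgebra.ι ℚ) : _ →ₗ⁅ℚ⁆ FreeAlgebra ℚ X).toLinearMap

/-- The right action `Z ↦ Z · x = μ̃(Z ⊗ x)` of an element `x` of a Lie algebra `L` on `L^{⊗ n}`:
the tensor product of right adjoint actions. -/
def adjAct {L : Type*} [LieRing L] [LieAlgebra ℚ L] {n : ℕ} (x : L) :
    Module.End ℚ (⨂[ℚ] _ : Fin n, L) :=
  act (mu n) ∘ₗ snoc.flip x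

/-- The extension of the right adjoint action of `Lie(X)` on `Lie(X)^{⊗ n}` to a right action of
the free associative algebra `T(X)`. -/
def assAct (X : Type) (n : ℕ) :
    FreeAlgebra ℚ X →ₐ[ℚ] (Module.End ℚ (⨂[ℚ] _ : Fin n, FreeLieAlgebra ℚ X))ᵐᵒᵖ :=
  FreeAlgebra.lift ℚ fun x => MulOpposite.op (adjAct (FreeLieAlgebra.of ℚ x))

/-- The word `x₁ x₂ ⋯ x_k` in the free associative algebra. -/
def word {X : Type} (w : List X) : FreeAlgebra ℚ X := (w.map (FreeAlgebra.ι ℚ)).prod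

/-- The components `P ↦ P_x` of the isomorphism `T̄(X) ≅ T(X) ⊗ ℚX`: one has
`P = P_∅ + ∑ₓ P_x x` with `P_∅` a scalar. On words, `(w x)_x = w`, while `(w y)_x = 0` for
`y ≠ x` and `1_x = 0`. -/
def lastQuot {X : Type} [DecidableEq X] (x : X) : FreeAlgebra ℚ X →ₗ[ℚ] FreeAlgebra ℚ X :=
  (FreeAlgebra.basisFreeMonoid ℚ X).constr ℚ fun w =>
    if w.toList.getLast? = some x then word w.toList.dropLast else 0

theorem basisFreeMonoid_eq_word {X : Type} (w : FreeMonoid X) :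
    FreeAlgebra.basisFreeMonoid ℚ X w = word w.toList := by
  simp only [FreeAlgebra.basisFreeMonoid, word]
  simp [FreeAlgebra.equivMonoidAlgebraFreeMonoid, FreeMonoid.lift_apply]

theorem lastQuot_word {X : Type} [DecidableEq X] (x : X) (w : List X) :
    lastQuot x (word w) = if w.getLast? = some x then word w.dropLast else 0 := by
  have := (FreeAlgebra.basisFreeMonoid ℚ X).constr_basis ℚ (fun w =>
    if w.toList.getLast? = some x then (word w.toList.dropLast : FreeAlgebra ℚ X) else 0)
    (FreeMonoid.ofList w)
  rwa [basisFreeMonoid_eq_word] at this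

/-- The linear map `Lie(X)^{⊗ n} ⊗ Lie(X) → Lie(X)^{⊗ n} ⊗ ℚX ⊆ Lie(X)^{⊗ n} ⊗ Lie(X)` sending
`Z ⊗ P` to `∑ₓ (Z · P_x) ⊗ x`, where `P ∈ Lie(X) ⊆ T̄(X)` is written `P = ∑ₓ P_x x`. -/
def projTensors (m n : ℕ) : (⨂[ℚ] _ : Fin (n + 1), FreeLieAlgebra ℚ (Fin m)) →ₗ[ℚ]
    ⨂[ℚ] _ : Fin (n + 1), FreeLieAlgebra ℚ (Fin m) :=
  unsnoc (LinearMap.mk₂ ℚ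
    (fun Z P => ∑ x : Fin m, snoc ((assAct (Fin m) n (lastQuot x (toAss (Fin m) P))).unop Z)
      (FreeLieAlgebra.of ℚ x))
    (fun _ _ _ => by simp [Finset.sum_add_distrib])
    (fun _ _ _ => by simp [Finset.smul_sum])
    (fun _ _ _ => by simp [Finset.sum_add_distrib])
    (fun _ _ _ => by simp [Finset.smul_sum]))

theorem projTensors_tprod {m n : ℕ} (z : Fin (n + 1) → FreeLieAlgebra ℚ (Fin m)) :
    projTensors m n (PiTensorProduct.tprod ℚ z) = ∑ x : Fin m,
      snoc ((assAct (Fin m) n (lastQuot x (toAss (Fin m) (z (Fin.last n))))).unop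
        (PiTensorProduct.tprod ℚ (Fin.init z))) (FreeLieAlgebra.of ℚ x) := by
  rw [projTensors, unsnoc_tprod, LinearMap.mk₂_apply]

theorem adjAct_tprod {L : Type*} [LieRing L] [LieAlgebra ℚ L] {n : ℕ} (x : L) (z : Fin n → L) :
    adjAct x (PiTensorProduct.tprod ℚ z) =
      ∑ i, PiTensorProduct.tprod ℚ (Function.update z i ⁅z i, x⁆) := by
  simp only [adjAct, LinearMap.comp_apply, LinearMap.flip_apply, snoc_tprod, mu, map_sum,
    LinearMap.sum_apply, act_tprod, subst_tprod]
  refine Finset.sum_congr rfl fun i _ => congrArg _ (funext fun j => ?_)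
  by_cases h : j = i
  · subst h; simp
  · simp [Function.update_of_ne h]

/-- The span of the tensors `z₁ ⊗ ⋯ ⊗ z_n` that are jointly multilinear in the generators in `S`. -/
def tensorsOver {X : Type} [DecidableEq X] (n : ℕ) (S : Finset X) :
    Submodule ℚ (⨂[ℚ] _ : Fin n, FreeLieAlgebra ℚ X) :=
  Submodule.span ℚ {t | ∃ (c : Fin n → Finset X) (z : Fin n → FreeLieAlgebra ℚ X),
    (∀ i j, i ≠ j → Disjoint (c i) (c j)) ∧ Finset.univ.biUnion c = S ∧
    (∀ i, z i ∈ lieOn (c i)) ∧ t = PiTensorProduct.tprod ℚ z}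

theorem adjAct_mem_tensorsOver {X : Type} [DecidableEq X] {n : ℕ} {S : Finset X} {x : X}
    (hx : x ∉ S) {t : ⨂[ℚ] _ : Fin n, FreeLieAlgebra ℚ X} (ht : t ∈ tensorsOver n S) :
    adjAct (FreeLieAlgebra.of ℚ x) t ∈ tensorsOver n (insert x S) := by
  induction ht using Submodule.span_induction with
  | mem t ht =>
    obtain ⟨c, z, hc, hS, hz, rfl⟩ := ht
    have hxc : ∀ i, x ∉ c i := fun i h =>
      hx (hS ▸ Finset.mem_biUnion.2 ⟨i, Finset.mem_univ i, h⟩)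
    rw [adjAct_tprod]
    refine Submodule.sum_mem _ fun i _ => Submodule.subset_span
      ⟨Function.update c i (c i ∪ {x}), _, fun j k hjk => ?_, ?_, fun j => ?_, rfl⟩
    · by_cases hj : j = i
      · subst hj
        rw [Function.update_self, Function.update_of_ne hjk.symm, Finset.disjoint_union_left]
        exact ⟨hc _ _ hjk, Finset.disjoint_singleton_left.2 (hxc k)⟩
      · rw [Function.update_of_ne hj]
        by_cases hk : k = i
        · subst hk
          rw [Function.update_self, Finset.disjoint_union_right]
          exact ⟨hc _ _ hjk, Finset.disjoint_singleton_right.2 (hxc j)⟩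
        · rw [Function.update_of_ne hk]; exact hc _ _ hjk
    · rw [← hS]
      ext y
      simp only [Finset.mem_biUnion, Finset.mem_univ, true_and, Finset.mem_insert]
      constructor
      · rintro ⟨j, hj⟩
        by_cases h : j = i
        · subst h
          rw [Function.update_self, Finset.mem_union, Finset.mem_singleton] at hj
          exact hj.symm.imp id fun h => ⟨j, h⟩
        · rw [Function.update_of_ne h] at hj
          exact Or.inr ⟨j, hj⟩
      · rintro (rfl | ⟨j, hj⟩)
        · exact ⟨i, by simp⟩
        · refine ⟨j, ?_⟩
          by_cases h : j = i
          · subst h; simp [hj]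
          · rwa [Function.update_of_ne h]
    · by_cases h : j = i
      · subst h
        rw [Function.update_self, Function.update_self]
        exact lie_mem_lieOn (Finset.disjoint_singleton_right.2 (hxc j)) (hz j) (of_mem_lieOn x)
      · rw [Function.update_of_ne h, Function.update_of_ne h]; exact hz j
  | zero => rw [map_zero]; exact zero_mem _
  | add x y _ _ hx hy => rw [map_add]; exact add_mem hx hy
  | smul c x _ hx => rw [map_smul]; exact Submodule.smul_mem _ _ hx

theorem assAct_word_mem {X : Type} [DecidableEq X] {n : ℕ} (w : List X) (hw : w.Nodup)
    {S : Finset X} (hS : Disjoint S w.toFinset) {t : ⨂[ℚ] _ : Fin n, FreeLieAlgebra ℚ X}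
    (ht : t ∈ tensorsOver n S) :
    (assAct X n (word w)).unop t ∈ tensorsOver n (S ∪ w.toFinset) := by
  induction w generalizing S t with
  | nil => simpa [word] using ht
  | cons x w ih =>
    have hxw := (List.nodup_cons.1 hw).1
    rw [List.toFinset_cons, Finset.disjoint_insert_right] at hS
    have h1 := ih (List.nodup_cons.1 hw).2
      (S := insert x S) (Finset.disjoint_insert_left.2 ⟨by simpa using hxw, hS.2⟩)
      (adjAct_mem_tensorsOver hS.1 ht)
    have h2 : insert x S ∪ w.toFinset = S ∪ (x :: w).toFinset := by
      ext y; simp only [Finset.mem_union, Finset.mem_insert, List.toFinset_cons]; tauto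
    rw [h2] at h1
    simpa [word, assAct, Module.End.mul_apply] using h1

theorem toAss_mem {X : Type} [DecidableEq X] {S : Finset X} {P : FreeLieAlgebra ℚ X}
    (hP : P ∈ lieOn S) :
    toAss X P ∈ Submodule.span ℚ {Q | ∃ w : List X, w.Nodup ∧ w.toFinset = S ∧ Q = word w} := by
  have mul_mem : ∀ {S T : Finset X} {a b : FreeAlgebra ℚ X}, Disjoint S T →
      a ∈ Submodule.span ℚ {Q | ∃ w : List X, w.Nodup ∧ w.toFinset = S ∧ Q = word w} →
      b ∈ Submodule.span ℚ {Q | ∃ w : List X, w.Nodup ∧ w.toFinset = T ∧ Q = word w} →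
      a * b ∈ Submodule.span ℚ
        {Q | ∃ w : List X, w.Nodup ∧ w.toFinset = S ∪ T ∧ Q = word w} := by
    intro S T a b h ha hb
    have := Submodule.mul_mem_mul ha hb
    rw [Submodule.span_mul_span] at this
    refine Submodule.span_mono ?_ this
    rintro _ ⟨_, ⟨w, hw, rfl, rfl⟩, _, ⟨w', hw', rfl, rfl⟩, rfl⟩
    refine ⟨w ++ w', List.nodup_append.2 ⟨hw, hw', fun x hx y hy e => ?_⟩, by simp,
      by simp [word]⟩
    exact Finset.disjoint_left.1 h (List.mem_toFinset.2 hx) (List.mem_toFinset.2 (e ▸ hy))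
  induction hP using Submodule.span_induction with
  | mem P hP =>
    induction hP with
    | of x => exact Submodule.subset_span ⟨[x], by simp, by simp, by simp [toAss, word]⟩
    | @lie S T a b h _ _ ha hb =>
      have : toAss X ⁅a, b⁆ = toAss X a * toAss X b - toAss X b * toAss X a := by
        simp [toAss, LieRing.of_associative_ring_bracket]
      rw [this]
      refine sub_mem (mul_mem h ha hb) ?_
      rw [Finset.union_comm]
      exact mul_mem h.symm hb ha
  | zero => rw [map_zero]; exact zero_mem _
  | add x y _ _ hx hy => rw [map_add]; exact add_mem hx hy
  | smul c x _ hx => rw [map_smul]; exact Submodule.smul_mem _ _ hx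

theorem snoc_mem_delta1Tensors {m n : ℕ} {S : Finset (Fin m)} {x : Fin m} (hx : x ∉ S)
    (hS : insert x S = Finset.univ) {t : ⨂[ℚ] _ : Fin n, FreeLieAlgebra ℚ (Fin m)}
    (ht : t ∈ tensorsOver n S) : snoc t (FreeLieAlgebra.of ℚ x) ∈ delta1Tensors m n := by
  induction ht using Submodule.span_induction with
  | mem t ht =>
    obtain ⟨c, z, hc, hcS, hz, rfl⟩ := ht
    rw [snoc_tprod]
    by_cases hne : ∃ i, c i = ∅
    · obtain ⟨i, hi⟩ := hne
      have h0 : z i = 0 := eq_zero_of_mem_lieOn_empty (hi ▸ hz i)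
      rw [MultilinearMap.map_coord_zero _ i.castSucc (by simpa using h0)]
      exact zero_mem _
    · push Not at hne
      have hex : ∀ y, y ≠ x → ∃ i, y ∈ c i := fun y hy => by
        have : y ∈ insert x S := hS ▸ Finset.mem_univ y
        rw [← hcS] at this
        simpa [hy] using this
      have hxc : ∀ i, x ∉ c i := fun i h =>
        hx (hcS ▸ Finset.mem_biUnion.2 ⟨i, Finset.mem_univ i, h⟩)
      choose g hg using hex
      have hgu : ∀ y hyx i, y ∈ c i → g y hyx = i := fun y hyx i hy => by
        by_contra h
        exact Finset.disjoint_left.1 (hc _ _ h) (hg y hyx) hy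
      let f : Fin m → Fin (n + 1) := fun y =>
        if h : y = x then Fin.last n else (g y h).castSucc
      have hlast : (Finset.univ.filter fun y => f y = Fin.last n) = {x} := by
        ext y
        by_cases h : y = x <;> simp [f, h, Fin.castSucc_ne_last]
      have hcast : ∀ i : Fin n, (Finset.univ.filter fun y => f y = i.castSucc) = c i := by
        intro i
        ext y
        by_cases h : y = x
        · simp [f, h, hxc i, (Fin.castSucc_ne_last i).symm]
        · simp only [f, h, dite_false, Finset.mem_filter, Finset.mem_univ, true_and,
            Fin.castSucc_inj]
          exact ⟨fun e => e ▸ hg y h, hgu y h i⟩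
      have hf : Function.Surjective f := fun j => by
        induction j using Fin.lastCases with
        | last => exact ⟨x, by simp [f]⟩
        | cast i =>
          obtain ⟨y, hy⟩ := hne i
          exact ⟨y, by rw [← hcast i] at hy; exact (Finset.mem_filter.1 hy).2⟩
      refine le_iSup (fun f : {f : Fin m → Fin (n + 1) // Function.Surjective f ∧
        (Finset.univ.filter fun x => f x = Fin.last n).card = 1} => tensorsOfType f.1)
        ⟨f, hf, by rw [hlast]; simp⟩ (Submodule.subset_span ⟨_, fun j => ?_, rfl⟩)
      induction j using Fin.lastCases with
      | last => rw [Fin.snoc_last, hlast]; exact of_mem_lieOn x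
      | cast i => rw [Fin.snoc_castSucc, hcast]; exact hz i
  | zero => rw [map_zero]; exact zero_mem _
  | add x y _ _ hx hy => rw [map_add, LinearMap.add_apply]; exact add_mem hx hy
  | smul c x _ hx =>
    rw [map_smul, LinearMap.smul_apply]; exact Submodule.smul_mem _ _ hx

theorem projTensors_mem {m n : ℕ} {t : ⨂[ℚ] _ : Fin (n + 1), FreeLieAlgebra ℚ (Fin m)}
    (ht : t ∈ catLieHom m (n + 1)) : projTensors m n t ∈ delta1Tensors m n := by
  refine catLieHom_induction (P := fun t => projTensors m n t ∈ delta1Tensors m n)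
    (fun f z hf hz => ?_) ?_ (fun x y hx hy => ?_) (fun c x hx => ?_) ht
  · rw [projTensors_tprod]
    refine Submodule.sum_mem _ fun x _ => ?_
    set S : Finset (Fin m) := Finset.univ.filter fun y => f y ≠ Fin.last n with hSdef
    have hZ : PiTensorProduct.tprod ℚ (Fin.init z) ∈ tensorsOver n S := by
      refine Submodule.subset_span ⟨fun i => Finset.univ.filter fun y => f y = i.castSucc, _,
        fun i j hij => Finset.disjoint_filter.2 fun y _ h1 h2 =>
          hij (Fin.castSucc_injective _ (h1.symm.trans h2)), ?_, fun i => hz i.castSucc, rfl⟩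
      ext y
      simp only [Finset.mem_biUnion, Finset.mem_univ, true_and, Finset.mem_filter, hSdef]
      exact ⟨fun ⟨i, hi⟩ => hi ▸ Fin.castSucc_ne_last i,
        fun h => ⟨(f y).castPred h, by simp⟩⟩
    have hP := toAss_mem (hz (Fin.last n))
    generalize toAss (Fin m) (z (Fin.last n)) = Q at hP ⊢
    induction hP using Submodule.span_induction with
    | mem Q hQ =>
      obtain ⟨w, hw, hwS, rfl⟩ := hQ
      rw [lastQuot_word]
      split_ifs with hl
      · obtain ⟨w', rfl⟩ := List.getLast?_eq_some_iff.1 hl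
        rw [List.dropLast_concat]
        have hw' := List.nodup_append.1 hw
        have hmem : ∀ y, y ∈ w' ++ [x] ↔ f y = Fin.last n := fun y => by
          rw [← List.mem_toFinset, hwS]; simp
        have hd : Disjoint S w'.toFinset := Finset.disjoint_left.2 fun y hy hy' =>
          (Finset.mem_filter.1 hy).2
            ((hmem y).1 (List.mem_append_left _ (List.mem_toFinset.1 hy')))
        refine snoc_mem_delta1Tensors ?_ ?_ (assAct_word_mem w' hw'.1 hd hZ)
        · rw [Finset.mem_union, not_or]
          refine ⟨fun h => (Finset.mem_filter.1 h).2 ((hmem x).1 (by simp)), fun h => ?_⟩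
          exact hw'.2.2 x (List.mem_toFinset.1 h) x (by simp) rfl
        · ext y
          have := hmem y
          simp only [List.mem_append, List.mem_singleton] at this
          simp only [Finset.mem_insert, Finset.mem_union, List.mem_toFinset, hSdef,
            Finset.mem_filter, Finset.mem_univ, true_and, iff_true]
          tauto
      · simp
    | zero => simp
    | add x y _ _ hx hy =>
      simp only [map_add, MulOpposite.unop_add, LinearMap.add_apply]
      exact add_mem hx hy
    | smul c x _ hx =>
      simp only [map_smul, MulOpposite.unop_smul, LinearMap.smul_apply]
      exact Submodule.smul_mem _ _ hx
  · rw [map_zero]; exact zero_mem _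
  · rw [map_add]; exact add_mem hx hy
  · rw [map_smul]; exact Submodule.smul_mem _ _ hx

theorem delta1Tensors_le (m n : ℕ) : delta1Tensors m n ≤ catLieHom m (n + 1) :=
  iSup_le fun f => tensorsOfType_le f.2.1

/-- The map `π : δ Cat 𝔏𝔦𝔢 → δ⁽¹⁾ Cat 𝔏𝔦𝔢`, i.e. the composite
`Cat 𝔏𝔦𝔢 ⊙ 𝔏𝔦𝔢 → Cat 𝔏𝔦𝔢 ⊙ 𝔄𝔰𝔰 ≅ Cat 𝔏𝔦𝔢 ⊙ 𝔄𝔰𝔰ᵘ ⊙ I → Cat 𝔏𝔦𝔢 ⊙ I`. -/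
def proj (m n : CatLie) : (m ⟶ boxOne.obj n) →ₗ[ℚ] delta1 m n where
  toFun t := ⟨⟨projTensors m.arity n.arity t.1, delta1Tensors_le _ _ (projTensors_mem t.2)⟩,
    projTensors_mem t.2⟩
  map_add' s t := Subtype.ext (Subtype.ext ((projTensors m.arity n.arity).map_add s.1 t.1))
  map_smul' c t := Subtype.ext (Subtype.ext ((projTensors m.arity n.arity).map_smul c t.1))

end Projection

end LieProp

/-! Write $Z\cdot x$ for the diagonal right adjoint action. The map π is a projection: on δ⁽¹⁾ the
last factor is a multiple $cx$ of a generator, whose only nonzero quotient is the constant $c$, so π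
is the identity there (`projTensors_eq_self`). A structure for which π is a morphism must therefore
satisfy $g\cdot t=\pi(g\cdot t)$ for $t$ in δ⁽¹⁾, and likewise on the right, which is uniqueness.
These formulas define a structure as soon as the kernel of π is stable under both actions, that is,
$\pi(g\cdot\pi(t))=\pi(g\cdot t)$ on each side.

Left side: by Leibniz, every morphism of Cat 𝔏𝔦𝔢 acts equivariantly for $Z\mapsto Z\cdot x$
(`act_adjAct`), hence for the extended action of $T(X)$. So π commutes with $\varphi\boxplus 1$
exactly.

Right side: precomposition substitutes $a_x$ for $x$. From $P=\sum_x P_x x$ follows $P(a)=\sum_x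
P_x(a)a_x$. Lie elements have no constant term, so the last letter is always read off from $a_x$,
which gives the chain rule $P(a)_y=\sum_x P_x(a)(a_x)_y$ (`lastQuot_toAss_lift`). Letting both sides
act on $Z(a)$ yields the required identity (`projTensors_subst`).

Finally $\tilde\mu(Z\otimes P)=Z\cdot P=\sum_x(Z\cdot P_x)\cdot x$, so
$\tilde\mu^{(1)}\circ\pi=\tilde\mu$ (`act_mu_projTensors`). The map $\tilde\mu$ is a morphism, by
equivariance on the left and associativity on the right, and this descends along the surjection π.
-/

namespace LieProp

/-! ### Equivariance of the Cat 𝔏𝔦𝔢-action under the adjoint action -/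

section Derivation

variable {L : Type*} [LieRing L] [LieAlgebra ℚ L]

/-- The map $[-,x]$ is a derivation, and each variable of $S$ occurs once in each monomial, so
Leibniz gives one term per variable. -/
theorem lie_lift_eq_sum_update {X : Type} [DecidableEq X] {S : Finset X} {z : FreeLieAlgebra ℚ X}
    (h : z ∈ lieOn S) (a : X → L) (x : L) :
    ⁅FreeLieAlgebra.lift ℚ a z, x⁆ =
      ∑ i ∈ S, FreeLieAlgebra.lift ℚ (Function.update a i ⁅a i, x⁆) z := by
  induction h using Submodule.span_induction with
  | mem z hz =>
    induction hz with
    | of y => simp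
    | @lie S T p q h hp hq hp' hq' =>
      -- A variable of one factor does not occur in the other, so updating it leaves the other
      -- factor's value unchanged. The sum over $S\cup T$ then becomes the two Leibniz terms, and
      -- Jacobi finishes.
      have hS : ∀ i ∈ S, FreeLieAlgebra.lift ℚ (Function.update a i ⁅a i, x⁆) q =
          FreeLieAlgebra.lift ℚ a q := fun i hi =>
        lift_congr_of_mem (Submodule.subset_span hq) fun y hy =>
          Function.update_of_ne (fun e => Finset.disjoint_left.1 h hi (Eq.subst e hy)) _ _
      have hT : ∀ i ∈ T, FreeLieAlgebra.lift ℚ (Function.update a i ⁅a i, x⁆) p =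
          FreeLieAlgebra.lift ℚ a p := fun i hi =>
        lift_congr_of_mem (Submodule.subset_span hp) fun y hy =>
          Function.update_of_ne (fun e => Finset.disjoint_left.1 h hy (Eq.subst e.symm hi)) _ _
      simp only [LieHom.map_lie]
      rw [Finset.sum_union h, Finset.sum_congr rfl fun i hi => by rw [hS i hi],
        Finset.sum_congr (s₁ := T) rfl fun i hi => by rw [hT i hi], ← sum_lie, ← lie_sum,
        ← hp', ← hq', lie_lie, ← lie_skew ⁅FreeLieAlgebra.lift ℚ a p, x⁆]
      abel
  | zero => simp
  | add y z _ _ hy hz => simp only [map_add, add_lie, hy, hz, Finset.sum_add_distrib]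
  | smul c y _ hy => simp only [map_smul, smul_lie, hy, Finset.smul_sum]

/-- Each variable $i$ occurs only in the tensor factor $f(i)$. Grouping the variables by the fibres
of $f$ reduces the claim to the Leibniz expansion in each single factor. -/
theorem sum_subst_update {n p : ℕ} {t : ⨂[ℚ] _ : Fin p, FreeLieAlgebra ℚ (Fin n)}
    (ht : t ∈ catLieHom n p) (a : Fin n → L) (x : L) :
    ∑ i, subst p (Function.update a i ⁅a i, x⁆) t = adjAct x (subst p a t) := by
  refine catLieHom_induction
    (P := fun t => ∑ i, subst p (Function.update a i ⁅a i, x⁆) t = adjAct x (subst p a t))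
    (fun f z _ hz => ?_) ?_ (fun u v hu hv => ?_) (fun c u hu => ?_) ht
  · have h1 : ∀ i, subst p (Function.update a i ⁅a i, x⁆) (PiTensorProduct.tprod ℚ z) =
        PiTensorProduct.tprod ℚ (Function.update (fun j => FreeLieAlgebra.lift ℚ a (z j)) (f i)
          (FreeLieAlgebra.lift ℚ (Function.update a i ⁅a i, x⁆) (z (f i)))) := fun i => by
      -- Taking `a i` as the reference value makes the base tensor the one obtained from the
      -- unmodified `a`.
      rw [subst_tprod, subst_aux f z hz a i ⁅a i, x⁆ (a i), Function.update_eq_self]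
    rw [Finset.sum_congr rfl fun i _ => h1 i, subst_tprod, adjAct_tprod,
      ← Finset.sum_fiberwise Finset.univ f]
    refine Finset.sum_congr rfl fun j _ => ?_
    rw [lie_lift_eq_sum_update (hz j), MultilinearMap.map_update_sum]
    refine Finset.sum_congr rfl fun i hi => ?_
    rw [(Finset.mem_filter.1 hi).2]
  · simp
  · simp only [map_add, Finset.sum_add_distrib, hu, hv]
  · simp only [map_smul, ← Finset.smul_sum, hu]

/-- The left action of `Cat 𝔏𝔦𝔢` on tensor powers of `L` is `L`-equivariant. -/
theorem act_adjAct {n p : ℕ} (φ : catLieHom n p) (x : L) (Z : ⨂[ℚ] _ : Fin n, L) :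
    act φ (adjAct x Z) = adjAct x (act φ Z) := by
  have : act φ ∘ₗ adjAct x = adjAct x ∘ₗ act φ := by
    refine PiTensorProduct.ext (MultilinearMap.ext fun a => ?_)
    simp only [LinearMap.compMultilinearMap_apply, LinearMap.comp_apply, adjAct_tprod, map_sum,
      act_tprod]
    exact sum_subst_update φ.2 a x
  exact congrArg (fun F : _ →ₗ[ℚ] _ => F Z) this

/-- Linear maps on `L^{⊗ (n+1)}` that agree on the tensors `Z ⊗ x` are equal. -/
theorem ext_snoc {n : ℕ} {W : Type*} [AddCommGroup W] [Module ℚ W]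
    {F G : (⨂[ℚ] _ : Fin (n + 1), L) →ₗ[ℚ] W} (h : ∀ Z x, F (snoc Z x) = G (snoc Z x)) : F = G :=
  PiTensorProduct.ext (MultilinearMap.ext fun z => by
    have := h (PiTensorProduct.tprod ℚ (Fin.init z)) (z (Fin.last n))
    rwa [snoc_tprod, Fin.snoc_init_self] at this)

theorem unsnoc_snoc {n : ℕ} {W : Type*} [AddCommGroup W] [Module ℚ W]
    (β : (⨂[ℚ] _ : Fin n, L) →ₗ[ℚ] L →ₗ[ℚ] W) (Z : ⨂[ℚ] _ : Fin n, L) (x : L) :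
    unsnoc β (snoc Z x) = β Z x := by
  have : unsnoc β ∘ₗ (snoc (n := n)).flip x = β.flip x := by
    refine PiTensorProduct.ext (MultilinearMap.ext fun z => ?_)
    simp [snoc_tprod, unsnoc_tprod]
  exact congrArg (fun F : _ →ₗ[ℚ] _ => F Z) this

theorem adjAct_snoc {n : ℕ} (x y : L) (Z : ⨂[ℚ] _ : Fin n, L) :
    adjAct y (snoc Z x) = snoc (adjAct y Z) x + snoc Z ⁅x, y⁆ := by
  have : adjAct y ∘ₗ (snoc (n := n)).flip x =
      snoc.flip x ∘ₗ adjAct y + snoc.flip ⁅x, y⁆ := by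
    refine PiTensorProduct.ext (MultilinearMap.ext fun z => ?_)
    simp only [LinearMap.compMultilinearMap_apply, LinearMap.comp_apply, LinearMap.add_apply,
      LinearMap.flip_apply, snoc_tprod, adjAct_tprod, map_sum, Fin.sum_univ_castSucc,
      Fin.snoc_castSucc, Fin.snoc_last, Fin.snoc_update, Fin.update_snoc_last]
  exact congrArg (fun F : _ →ₗ[ℚ] _ => F Z) this

theorem act_mu_snoc {n : ℕ} (Z : ⨂[ℚ] _ : Fin n, L) (x : L) :
    act (mu n) (snoc Z x) = adjAct x Z := rfl

/-- This is `act_adjAct` read through $Z\otimes x\mapsto Z\cdot x$; it is the left linearity of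
$\tilde\mu$. -/
theorem act_mu_act_boxOneMap {n p : ℕ} (φ : catLieHom n p) (t : ⨂[ℚ] _ : Fin (n + 1), L) :
    act (mu p) (act (boxOneMap φ) t) = act φ (act (mu n) t) := by
  have : act (mu p) ∘ₗ act (boxOneMap φ) = act (L := L) φ ∘ₗ act (mu n) := ext_snoc fun Z x => by
    simp only [LinearMap.comp_apply, act_boxOneMap, act_mu_snoc, act_adjAct]
  exact congrArg (fun F : _ →ₗ[ℚ] _ => F t) this

/-- Equivariance applied to the morphism $\mu(n)$ itself, at $Z\otimes x$: expanding $(Z\otimes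
x)\cdot y$ by Leibniz gives $(Z\cdot y)\cdot x+Z\cdot[x,y]=(Z\cdot x)\cdot y$. -/
theorem adjAct_lie {n : ℕ} (x y : L) (Z : ⨂[ℚ] _ : Fin n, L) :
    adjAct ⁅x, y⁆ Z = adjAct y (adjAct x Z) - adjAct x (adjAct y Z) := by
  have := act_adjAct (mu n) y (snoc Z x)
  rw [adjAct_snoc, map_add] at this
  simp only [act_mu_snoc] at this
  rw [← this, add_sub_cancel_left]

theorem subst_adjAct {m n : ℕ} (a : Fin m → L) (x : FreeLieAlgebra ℚ (Fin m))
    (Z : ⨂[ℚ] _ : Fin n, FreeLieAlgebra ℚ (Fin m)) :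
    subst n a (adjAct x Z) = adjAct (FreeLieAlgebra.lift ℚ a x) (subst n a Z) := by
  rw [← act_mu_snoc, ← act_subst, subst_snoc, act_mu_snoc]

end Derivation

/-! ### Lie elements and last-letter quotients in the free associative algebra -/

section FreeAssociative

attribute [local instance] LieRing.ofAssociativeRing

variable {X : Type}

/-- The right adjoint action of `L` on `L^{⊗ n}` as a homomorphism of Lie algebras. -/
def adjActHom (L : Type*) [LieRing L] [LieAlgebra ℚ L] (n : ℕ) :
    L →ₗ⁅ℚ⁆ (Module.End ℚ (⨂[ℚ] _ : Fin n, L))ᵐᵒᵖ where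
  toFun x := MulOpposite.op (adjAct x)
  map_add' x y := MulOpposite.unop_injective (by
    ext Z; simp [adjAct])
  map_smul' c x := MulOpposite.unop_injective (by
    ext Z; simp [adjAct])
  -- The opposite algebra reverses composition, so its commutator matches the sign in `adjAct_lie`.
  map_lie' {x y} := MulOpposite.unop_injective (LinearMap.ext fun Z => by
    simp [LieRing.of_associative_ring_bracket, adjAct_lie])

/-- Both sides are Lie algebra homomorphisms in `u` that agree on generators. This makes `assAct` an
extension of the adjoint action of all Lie elements, not only of the letters. -/
theorem assAct_toAss (n : ℕ) (u : FreeLieAlgebra ℚ X) :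
    assAct X n (toAss X u) = MulOpposite.op (adjAct u) := by
  have : (assAct X n).toLieHom.comp (FreeLieAlgebra.lift ℚ (FreeAlgebra.ι ℚ)) =
      adjActHom (FreeLieAlgebra ℚ X) n :=
    FreeLieAlgebra.hom_ext fun x => by simp [assAct, adjActHom]
  exact congrArg (fun F : _ →ₗ⁅ℚ⁆ _ => F u) this

theorem toAss_of (x : X) : toAss X (FreeLieAlgebra.of ℚ x) = FreeAlgebra.ι ℚ x := by
  simp [toAss]

theorem toAss_lift {Y : Type} (a : X → FreeLieAlgebra ℚ Y) (u : FreeLieAlgebra ℚ X) :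
    toAss Y (FreeLieAlgebra.lift ℚ a u) =
      FreeAlgebra.lift ℚ (fun x => toAss Y (a x)) (toAss X u) := by
  have : (FreeLieAlgebra.lift ℚ (FreeAlgebra.ι ℚ)).comp (FreeLieAlgebra.lift ℚ a) =
      (FreeAlgebra.lift ℚ fun x => toAss Y (a x)).toLieHom.comp
        (FreeLieAlgebra.lift ℚ (FreeAlgebra.ι ℚ)) :=
    FreeLieAlgebra.hom_ext fun x => by simp [toAss]
  exact congrArg (fun F : _ →ₗ⁅ℚ⁆ _ => F u) this

/-- The augmentation kills the generators, so as a Lie homomorphism on the free Lie algebra it is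
zero. -/
theorem algebraMapInv_toAss (u : FreeLieAlgebra ℚ X) :
    FreeAlgebra.algebraMapInv (toAss X u) = (0 : ℚ) := by
  have : (FreeAlgebra.algebraMapInv : FreeAlgebra ℚ X →ₐ[ℚ] ℚ).toLieHom.comp
      (FreeLieAlgebra.lift ℚ (FreeAlgebra.ι ℚ)) = 0 :=
    FreeLieAlgebra.hom_ext fun x => by simp [FreeAlgebra.algebraMapInv]
  exact congrArg (fun F : _ →ₗ⁅ℚ⁆ _ => F u) this

theorem subst_assAct {m l n : ℕ} (a : Fin m → FreeLieAlgebra ℚ (Fin l))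
    (Q : FreeAlgebra ℚ (Fin m)) (Z : ⨂[ℚ] _ : Fin n, FreeLieAlgebra ℚ (Fin m)) :
    subst n a ((assAct (Fin m) n Q).unop Z) =
      (assAct (Fin l) n (FreeAlgebra.lift ℚ (fun x => toAss (Fin l) (a x)) Q)).unop
        (subst n a Z) := by
  induction Q using FreeAlgebra.induction generalizing Z with
  | grade0 r => simp [Algebra.algebraMap_eq_smul_one]
  | grade1 x =>
    rw [FreeAlgebra.lift_ι_apply, assAct_toAss, ← toAss_of, assAct_toAss, MulOpposite.unop_op,
      MulOpposite.unop_op, subst_adjAct, FreeLieAlgebra.lift_of_apply]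
  | mul P Q hP hQ => simp [hP, hQ]
  | add P Q hP hQ => simp [hP, hQ]

variable [DecidableEq X]

theorem lastQuot_mul_ι (x y : X) (Q : FreeAlgebra ℚ X) :
    lastQuot x (Q * FreeAlgebra.ι ℚ y) = if y = x then Q else 0 := by
  have : lastQuot x ∘ₗ LinearMap.mulRight ℚ (FreeAlgebra.ι ℚ y) =
      if y = x then LinearMap.id else 0 := by
    refine (FreeAlgebra.basisFreeMonoid ℚ X).ext fun w => ?_
    have h : word w.toList * FreeAlgebra.ι ℚ y = word (w.toList ++ [y]) := by simp [word]
    rw [basisFreeMonoid_eq_word, LinearMap.comp_apply, LinearMap.mulRight_apply, h, lastQuot_word]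
    by_cases hxy : y = x <;> simp [hxy]
  have := congrArg (fun F : _ →ₗ[ℚ] _ => F Q) this
  by_cases hxy : y = x <;> simpa [hxy] using this

/-- On the basis of words: the empty word contributes the constant term, and a word ending in $x$ is
recovered by the summand $y=x$ alone. -/
theorem eq_algebraMap_add_sum_lastQuot_mul_ι [Fintype X] (Q : FreeAlgebra ℚ X) :
    Q = FreeAlgebra.algebraMapInv Q • 1 + ∑ y, lastQuot y Q * FreeAlgebra.ι ℚ y := by
  have : LinearMap.id = (FreeAlgebra.algebraMapInv (R := ℚ) (X := X)).toLinearMap.smulRight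
        (1 : FreeAlgebra ℚ X) +
      ∑ y, LinearMap.mulRight ℚ (FreeAlgebra.ι ℚ y) ∘ₗ lastQuot y := by
    refine (FreeAlgebra.basisFreeMonoid ℚ X).ext fun w => ?_
    rw [basisFreeMonoid_eq_word]
    simp only [LinearMap.id_apply, LinearMap.add_apply, LinearMap.smulRight_apply,
      LinearMap.sum_apply, LinearMap.comp_apply, LinearMap.mulRight_apply, lastQuot_word,
      AlgHom.toLinearMap_apply]
    rcases List.eq_nil_or_concat w.toList with h | ⟨v, x, h⟩
    · simp [h, word]
    · simp [h, word, FreeAlgebra.algebraMapInv, ite_mul]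
  have := congrArg (fun F : _ →ₗ[ℚ] _ => F Q) this
  simpa using this

theorem toAss_eq_sum_lastQuot_mul_ι [Fintype X] (u : FreeLieAlgebra ℚ X) :
    toAss X u = ∑ y, lastQuot y (toAss X u) * FreeAlgebra.ι ℚ y := by
  conv_lhs => rw [eq_algebraMap_add_sum_lastQuot_mul_ι (toAss X u), algebraMapInv_toAss,
    zero_smul, zero_add]

/-- A Lie element has no constant term, so the last letter of the product always comes from it. -/
theorem lastQuot_mul_toAss [Fintype X] (x : X) (Q : FreeAlgebra ℚ X) (u : FreeLieAlgebra ℚ X) :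
    lastQuot x (Q * toAss X u) = Q * lastQuot x (toAss X u) := by
  conv_lhs => rw [toAss_eq_sum_lastQuot_mul_ι u, Finset.mul_sum]
  simp [← mul_assoc, lastQuot_mul_ι]

/-- A chain rule as for Fox derivatives: substitute into $u=\sum_x u_x x$, then strip the last
letter from the Lie element $a_x$ ending each product. -/
theorem lastQuot_toAss_lift [Fintype X] {Y : Type} [Fintype Y] [DecidableEq Y]
    (a : X → FreeLieAlgebra ℚ Y) (u : FreeLieAlgebra ℚ X) (y : Y) :
    lastQuot y (toAss Y (FreeLieAlgebra.lift ℚ a u)) =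
      ∑ x, FreeAlgebra.lift ℚ (fun x => toAss Y (a x)) (lastQuot x (toAss X u)) *
        lastQuot y (toAss Y (a x)) := by
  conv_lhs => rw [toAss_lift, toAss_eq_sum_lastQuot_mul_ι u]
  simp [lastQuot_mul_toAss]

end FreeAssociative

/-! ### Compatibility of π with both actions and with μ̃ -/

theorem projTensors_snoc {m n : ℕ} (Z : ⨂[ℚ] _ : Fin n, FreeLieAlgebra ℚ (Fin m))
    (P : FreeLieAlgebra ℚ (Fin m)) :
    projTensors m n (snoc Z P) = ∑ x : Fin m,
      snoc ((assAct (Fin m) n (lastQuot x (toAss (Fin m) P))).unop Z)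
        (FreeLieAlgebra.of ℚ x) := by
  rw [projTensors, unsnoc_snoc, LinearMap.mk₂_apply]

theorem act_assAct {m n p : ℕ} (φ : catLieHom n p) (Q : FreeAlgebra ℚ (Fin m))
    (Z : ⨂[ℚ] _ : Fin n, FreeLieAlgebra ℚ (Fin m)) :
    act φ ((assAct (Fin m) n Q).unop Z) = (assAct (Fin m) p Q).unop (act φ Z) := by
  induction Q using FreeAlgebra.induction generalizing Z with
  | grade0 r => simp [Algebra.algebraMap_eq_smul_one]
  | grade1 x =>
    rw [← toAss_of, assAct_toAss, assAct_toAss, MulOpposite.unop_op, MulOpposite.unop_op,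
      act_adjAct]
  | mul P Q hP hQ => simp [hP, hQ]
  | add P Q hP hQ => simp [hP, hQ]

/-- The morphism $\varphi\boxplus 1$ leaves the last factor alone, and $\varphi$ commutes with the
action of $T(X)$ on the others. -/
theorem projTensors_act_boxOneMap {m n p : ℕ} (φ : catLieHom n p)
    (t : ⨂[ℚ] _ : Fin (n + 1), FreeLieAlgebra ℚ (Fin m)) :
    projTensors m p (act (boxOneMap φ) t) = act (boxOneMap φ) (projTensors m n t) := by
  have : projTensors m p ∘ₗ act (boxOneMap φ) = act (boxOneMap φ) ∘ₗ projTensors m n :=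
    ext_snoc fun Z P => by
      simp only [LinearMap.comp_apply, act_boxOneMap, projTensors_snoc, map_sum, act_assAct]
  exact congrArg (fun F : _ →ₗ[ℚ] _ => F t) this

/-- The tensors $(Z\cdot P_x)(a)\otimes a_x$, projected again, give $Z(a)\cdot P_x(a)(a_x)_y\otimes
y$; summing over $x$ is the chain rule for $P(a)_y$. -/
theorem projTensors_subst {l m n : ℕ} (a : Fin m → FreeLieAlgebra ℚ (Fin l))
    (t : ⨂[ℚ] _ : Fin (n + 1), FreeLieAlgebra ℚ (Fin m)) :
    projTensors l n (subst (n + 1) a (projTensors m n t)) =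
      projTensors l n (subst (n + 1) a t) := by
  have : projTensors l n ∘ₗ subst (n + 1) a ∘ₗ projTensors m n =
      projTensors l n ∘ₗ subst (n + 1) a :=
    ext_snoc fun Z P => by
      simp only [LinearMap.comp_apply, projTensors_snoc, map_sum, subst_snoc,
        FreeLieAlgebra.lift_of_apply, subst_assAct, lastQuot_toAss_lift, map_mul,
        Finset.unop_sum, MulOpposite.unop_mul, LinearMap.sum_apply, Module.End.mul_apply]
      exact Finset.sum_comm
  exact congrArg (fun F : _ →ₗ[ℚ] _ => F t) this

/-- Applying $\mu$ to $(Z\cdot P_x)\otimes x$ puts the stripped letter back, and $\sum_x P_x x=P$ in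
$T(X)$. -/
theorem act_mu_projTensors {m n : ℕ} (t : ⨂[ℚ] _ : Fin (n + 1), FreeLieAlgebra ℚ (Fin m)) :
    act (mu n) (projTensors m n t) = act (mu n) t := by
  have : act (mu n) ∘ₗ projTensors m n = act (mu n) := ext_snoc fun Z P => by
    have h := congrArg (fun Q => (assAct (Fin m) n Q).unop Z) (toAss_eq_sum_lastQuot_mul_ι P)
    simp only [assAct_toAss, ← toAss_of, map_sum, map_mul, MulOpposite.unop_op, Finset.unop_sum,
      MulOpposite.unop_mul, LinearMap.sum_apply, Module.End.mul_apply] at h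
    simp only [LinearMap.comp_apply, projTensors_snoc, map_sum, act_mu_snoc, h]
  exact congrArg (fun F : _ →ₗ[ℚ] _ => F t) this

/-- A bracket would split the singleton into two disjoint nonempty sets. The index is a variable `S`
with an equation so that case analysis applies. -/
theorem IsLieMonomial.eq_of_singleton {X : Type} [DecidableEq X] {S : Finset X}
    {z : FreeLieAlgebra ℚ X} (h : IsLieMonomial S z) {x : X} (hS : S = {x}) :
    z = FreeLieAlgebra.of ℚ x := by
  cases h with
  | of y => rw [Finset.singleton_injective hS]
  | @lie S T a b h ha hb =>
    have h1 := (Finset.subset_singleton_iff'.1 (hS ▸ Finset.subset_union_left) : ∀ y ∈ S, y = x)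
    have h2 := (Finset.subset_singleton_iff'.1 (hS ▸ Finset.subset_union_right) : ∀ y ∈ T, y = x)
    obtain ⟨y, hy⟩ := ha.nonempty
    obtain ⟨y', hy'⟩ := hb.nonempty
    exact absurd hy' (Finset.disjoint_left.1 h ((h1 y hy).trans (h2 y' hy').symm ▸ hy))

theorem mem_span_of_mem_lieOn_singleton {X : Type} [DecidableEq X] {x : X}
    {z : FreeLieAlgebra ℚ X} (h : z ∈ lieOn {x}) :
    ∃ c : ℚ, c • FreeLieAlgebra.of ℚ x = z :=
  Submodule.mem_span_singleton.1
    (Submodule.span_mono (fun _ hz => Set.mem_singleton_iff.2 (hz.eq_of_singleton rfl)) h)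

theorem projTensors_eq_self {m n : ℕ} {t : ⨂[ℚ] _ : Fin (n + 1), FreeLieAlgebra ℚ (Fin m)}
    (ht : t ∈ delta1Tensors m n) : projTensors m n t = t := by
  suffices h : delta1Tensors m n ≤ LinearMap.eqLocus (projTensors m n) LinearMap.id from h ht
  refine iSup_le fun f => Submodule.span_le.2 ?_
  rintro _ ⟨z, hz, rfl⟩
  obtain ⟨x, hx⟩ := Finset.card_eq_one.1 f.2.2
  obtain ⟨c, hc⟩ := mem_span_of_mem_lieOn_singleton (hx ▸ hz (Fin.last n))
  have h : PiTensorProduct.tprod ℚ z =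
      c • snoc (PiTensorProduct.tprod ℚ (Fin.init z)) (FreeLieAlgebra.of ℚ x) := by
    rw [← map_smul, hc, snoc_tprod, Fin.snoc_init_self]
  -- The letter $x$ is viewed as $1\cdot x$.
  have hq : ∀ y, lastQuot y (FreeAlgebra.ι ℚ x) = if x = y then 1 else 0 := fun y => by
    simpa using lastQuot_mul_ι y x 1
  rw [SetLike.mem_coe, LinearMap.mem_eqLocus, h, map_smul, projTensors_snoc,
    Finset.sum_eq_single x]
  · simp [toAss_of, hq]
  · intro y _ hy
    simp [toAss_of, hq, hy.symm]
  · simp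

theorem proj_eq_self {m n : CatLie} (t : delta1 m n) : proj m n t.1 = t :=
  Subtype.ext (Subtype.ext (projTensors_eq_self t.2))

/-- On a pure tensor `r` the action is a substitution, so this is `projTensors_subst` extended by
linearity. The separate `s` is needed because `act` takes elements of `catLieHom`, not bare tensors.
-/
theorem projTensors_act_congr {l m n : ℕ} {s t : catLieHom m (n + 1)}
    (h : s.1 = projTensors m n t.1) {r : ⨂[ℚ] _ : Fin m, FreeLieAlgebra ℚ (Fin l)}
    (hr : r ∈ catLieHom l m) :
    projTensors l n (act s r) = projTensors l n (act t r) := by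
  refine catLieHom_induction (P := fun r => projTensors l n (act s r) = projTensors l n (act t r))
    (fun _ a _ _ => ?_) ?_ (fun x y hx hy => ?_) (fun c x hx => ?_) hr
  · rw [act_tprod, act_tprod, h, projTensors_subst]
  · simp only [map_zero]
  · simp only [map_add, hx, hy]
  · simp only [map_smul, hx]

theorem projTensors_act_boxOneMap_projTensors {m n p : ℕ} (φ : catLieHom n p)
    {t : ⨂[ℚ] _ : Fin (n + 1), FreeLieAlgebra ℚ (Fin m)} (ht : t ∈ catLieHom m (n + 1)) :
    projTensors m p (act (boxOneMap φ) (projTensors m n t)) =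
      projTensors m p (act (boxOneMap φ) t) := by
  rw [← projTensors_act_boxOneMap, projTensors_eq_self (projTensors_mem (act_mem _ ht))]

/-! ### The bimodule structure transported along π -/

theorem proj_left {m n p : CatLie} (g : n ⟶ p) (t : m ⟶ boxOne.obj n) :
    proj m p (deltaCatLie.left g (proj m n t).1) = proj m p (deltaCatLie.left g t) :=
  Subtype.ext (Subtype.ext (projTensors_act_boxOneMap_projTensors g t.2))

/-- With `proj_left`, this shows that the kernel of π is stable under both actions, so the quotient
structure on δ⁽¹⁾ is well defined. -/
theorem proj_right {l m n : CatLie} (f : l ⟶ m) (t : m ⟶ boxOne.obj n) :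
    proj l n (deltaCatLie.right f (proj m n t).1) = proj l n (deltaCatLie.right f t) :=
  Subtype.ext (Subtype.ext (projTensors_act_congr rfl f.2))

/-- The quotient bimodule structure on `δ⁽¹⁾ Cat 𝔏𝔦𝔢` along `π`. -/
def delta1Bimod : LinBimod CatLie (fun m n => delta1 m n) where
  left {m n p} := (deltaCatLie.left (m := m) (n := n) (p := p)).compr₂ (proj m p) |>.compl₂
    (delta1 m n).subtype
  right {l m n} := (deltaCatLie.right (l := l) (m := m) (n := n)).compr₂ (proj l n) |>.compl₂
    (delta1 m n).subtype
  left_id {m n} x := by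
    change proj m n (deltaCatLie.left (𝟙 n) x.1) = x
    rw [deltaCatLie.left_id, proj_eq_self]
  left_comp {m n p q} f g x := by
    change proj m q (deltaCatLie.left (f ≫ g) x.1) =
      proj m q (deltaCatLie.left g (proj m p (deltaCatLie.left f x.1)).1)
    rw [deltaCatLie.left_comp, proj_left]
  right_id {m n} x := by
    change proj m n (deltaCatLie.right (𝟙 m) x.1) = x
    rw [deltaCatLie.right_id, proj_eq_self]
  right_comp {k l m n} f g x := by
    change proj k n (deltaCatLie.right (f ≫ g) x.1) =
      proj k n (deltaCatLie.right f (proj l n (deltaCatLie.right g x.1)).1)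
    rw [deltaCatLie.right_comp, proj_right]
  left_right {l m n p} f g x := by
    change proj l p (deltaCatLie.left g (proj l n (deltaCatLie.right f x.1)).1) =
      proj l p (deltaCatLie.right f (proj m p (deltaCatLie.left g x.1)).1)
    rw [proj_left, proj_right, deltaCatLie.left_right]

theorem isHom_proj_delta1Bimod : LinBimod.IsHom deltaCatLie delta1Bimod proj where
  map_left g x := (proj_left g x).symm
  map_right f x := (proj_right f x).symm

/-- Since `x` equals its own projection, compatibility with π determines the action on it; this and
its right-hand analogue give uniqueness. -/
theorem LinBimod.IsHom.left_eq_proj {β : LinBimod CatLie (fun m n => delta1 m n)}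
    (hβ : LinBimod.IsHom deltaCatLie β proj) {m n p : CatLie} (g : n ⟶ p) (x : delta1 m n) :
    β.left g x = proj m p (deltaCatLie.left g x.1) := by
  rw [hβ.map_left, proj_eq_self]

theorem LinBimod.IsHom.right_eq_proj {β : LinBimod CatLie (fun m n => delta1 m n)}
    (hβ : LinBimod.IsHom deltaCatLie β proj) {l m n : CatLie} (f : l ⟶ m) (x : delta1 m n) :
    β.right f x = proj l n (deltaCatLie.right f x.1) := by
  rw [hβ.map_right, proj_eq_self]

theorem muTilde1_proj {m n : CatLie} (t : m ⟶ boxOne.obj n) :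
    muTilde1 m n (proj m n t) = muTilde catLieBimod m n t :=
  Subtype.ext (act_mu_projTensors t.1)

/-- The left part is equivariance; the right part holds because $\tilde\mu$ is itself a left action,
which commutes with right actions. -/
theorem isHom_muTilde : LinBimod.IsHom deltaCatLie catLieBimod (muTilde catLieBimod) where
  map_left g x := Subtype.ext (act_mu_act_boxOneMap g x.1)
  map_right f x := catLieBimod.left_right f _ x

theorem LinBimod.IsHom.muTilde1 {β : LinBimod CatLie (fun m n => delta1 m n)}
    (hβ : LinBimod.IsHom deltaCatLie β proj) : LinBimod.IsHom β catLieBimod muTilde1 where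
  map_left g x := by
    -- The identity $\tilde\mu^{(1)}\circ\pi=\tilde\mu$ removes the projection, leaving the
    -- linearity of $\tilde\mu$ at `x` seen in δ Cat 𝔏𝔦𝔢.
    rw [hβ.left_eq_proj, muTilde1_proj, isHom_muTilde.map_left]; rfl
  map_right f x := by
    rw [hβ.right_eq_proj, muTilde1_proj, isHom_muTilde.map_right]; rfl

end LieProp

theorem mainTheorem7 :
    (∃! β : LieProp.LinBimod LieProp.CatLie (fun m n => LieProp.delta1 m n),
      LieProp.LinBimod.IsHom LieProp.deltaCatLie β LieProp.proj) ∧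
    ∀ β : LieProp.LinBimod LieProp.CatLie (fun m n => LieProp.delta1 m n),
      LieProp.LinBimod.IsHom LieProp.deltaCatLie β LieProp.proj →
        LieProp.LinBimod.IsHom β LieProp.catLieBimod LieProp.muTilde1 := by
  refine ⟨⟨LieProp.delta1Bimod, LieProp.isHom_proj_delta1Bimod, fun β hβ => ?_⟩,
    fun β hβ => hβ.muTilde1⟩
  -- The two actions are the only data of a bimodule structure, and both are forced by π.
  refine LieProp.LinBimod.ext ?_ ?_
  · funext m n p
    exact LinearMap.ext fun g => LinearMap.ext fun x =>
      (hβ.left_eq_proj g x).trans (LieProp.isHom_proj_delta1Bimod.left_eq_proj g x).symm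
  · funext l m n
    exact LinearMap.ext fun f => LinearMap.ext fun x =>
      (hβ.right_eq_proj f x).trans (LieProp.isHom_proj_delta1Bimod.right_eq_proj f x).symm
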